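/- Let $A=\{a,b\}$, let $A^+$ be the free semigroup on $A$, and let $\tau$ be the Prouhet--Thue--Morse substitution, that is, the endomorphism of $A^+$ with $\tau(a)=ab$ and $\tau(b)=ba$. Let $L\subseteq A^+$ be the set of nonempty factors of the words $\tau^k(a)$, $\tau^k(b)$ with $k\ge 1$ (the language of finite blocks of the Prouhet--Thue--Morse subshift). Let $\overline{\Omega}_A\mathsf S$ be the free profinite semigroup on $A$ (the projective limit of the finite quotients of $A^+$), and let $J(\tau)=\overline{L}\setminus L$, where $\overline L$ is the topological closure of $L$ in $\overline{\Omega}_A\mathsf S$; this is the $\mathcal J$-class associated with the subshift. Let $G(\tau)$ be a maximal subgroup of $J(\tau)$, that is, for an idempotent $e\in J(\tau)$, the group of invertible elements of the monoid $e\,\overline{\Omega}_A\mathsf S\,e$, with the subspace topology; such idempotents exist, and $G(\tau)$ does not depend on $e$ up to isomorphism of topological groups. Let $H=(C_3\times C_3)\rtimes C_2$, where the generator of $C_2$ acts on $C_3\times C_3$ by inversion. Then $H$ has order $18$ and rank three (its least number of generators is $3$), and there is a continuous surjective homomorphism from $G(\tau)$ onto the discrete group $H$. Moreover, $G(\tau)$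 has rank exactly three: the least cardinality of a set generating a dense subgroup of $G(\tau)$ is $3$. -/

import Mathlib

/-! Free profinite semigroups -/

/-- A congruence on the free semigroup `A⁺` whose quotient semigroup is finite. -/
abbrev FinCon (A : Type) : Type :=
  {c : Con (FreeSemigroup A) // Finite c.Quotient}

/-- The finite quotients of `A⁺` carry the discrete topology. -/
instance finConQuotientTopology {A : Type} (c : FinCon A) : TopologicalSpace c.1.Quotient := ⊥

/-- The free profinite semigroup on `A`: the projective limit of all finite quotients of the free
semigroup `A⁺`, as a subsemigroup of their product (with componentwise multiplication). A point is a
family `x` with `x c` in the quotient by `c` such that, for `c ≤ d`, the canonical map from the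
quotient by `c` to the quotient by `d` sends `x c` to `x d`. -/
def freeProfiniteSubsemigroup (A : Type) : Subsemigroup (∀ c : FinCon A, c.1.Quotient) where
  carrier := {x | ∀ c d : FinCon A, c.1 ≤ d.1 →
    ∀ w : FreeSemigroup A, x c = (w : c.1.Quotient) → x d = (w : d.1.Quotient)}
  mul_mem' := by
    intro x y hx hy c d hcd w hw
    obtain ⟨u, hu⟩ := Quotient.exists_rep (x c)
    obtain ⟨v, hv⟩ := Quotient.exists_rep (y c)
    have hu' : x c = (u : c.1.Quotient) := hu.symm
    have hv' : y c = (v : c.1.Quotient) := hv.symm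
    have h1 : ((u * v : FreeSemigroup A) : c.1.Quotient) = (w : c.1.Quotient) := by
      rw [← hw, Con.coe_mul, ← hu', ← hv']
      rfl
    have h2 : ((u * v : FreeSemigroup A) : d.1.Quotient) = (w : d.1.Quotient) :=
      (Con.eq d.1).2 (hcd ((Con.eq c.1).1 h1))
    rw [← h2, Con.coe_mul, ← hx c d hcd u hu', ← hy c d hcd v hv']
    rfl

/-- The free profinite semigroup on `A`; its topology is the one induced by the product of the
discrete topologies. -/
abbrev FreeProfiniteSemigroup (A : Type) : Type := freeProfiniteSubsemigroup A

/-- The canonical map from words to the free profinite semigroup. -/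
def FreeProfiniteSemigroup.ofWord {A : Type} (w : FreeSemigroup A) : FreeProfiniteSemigroup A :=
  ⟨fun c => (w : c.1.Quotient), fun c d hcd _ hv =>
    (Con.eq d.1).2 (hcd ((Con.eq c.1).1 hv))⟩

/-! Maximal subgroups of a semigroup -/

/-- The maximal subgroup of the semigroup `S` with identity the idempotent `e`: the elements of the
local monoid `e S e` that are invertible in it. -/
def MaximalSubgroup {S : Type} [Semigroup S] (e : S) (_he : e * e = e) : Type :=
  {x : S // e * x = x ∧ x * e = x ∧ ∃ y : S, e * y = y ∧ y * e = y ∧ x * y = e ∧ y * x = e}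

namespace MaximalSubgroup

variable {S : Type} [Semigroup S] {e : S} {he : e * e = e}

/-- The subspace topology. -/
instance [TopologicalSpace S] : TopologicalSpace (MaximalSubgroup e he) :=
  inferInstanceAs (TopologicalSpace {x : S // e * x = x ∧ x * e = x ∧
    ∃ y : S, e * y = y ∧ y * e = y ∧ x * y = e ∧ y * x = e})

theorem mul_prop (x y : MaximalSubgroup e he) : e * (x.1 * y.1) = x.1 * y.1 ∧
    x.1 * y.1 * e = x.1 * y.1 ∧
    ∃ z : S, e * z = z ∧ z * e = z ∧ x.1 * y.1 * z = e ∧ z * (x.1 * y.1) = e := by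
  obtain ⟨hx1, hx2, x', hx3, hx4, hx5, hx6⟩ := x.2
  obtain ⟨hy1, hy2, y', hy3, hy4, hy5, hy6⟩ := y.2
  refine ⟨by rw [← mul_assoc, hx1], by rw [mul_assoc, hy2], y' * x', by rw [← mul_assoc, hy3],
    by rw [mul_assoc, hx4], ?_, ?_⟩
  · calc x.1 * y.1 * (y' * x') = x.1 * ((y.1 * y') * x') := by simp only [mul_assoc]
      _ = e := by rw [hy5, hx3, hx5]
  · calc y' * x' * (x.1 * y.1) = y' * ((x' * x.1) * y.1) := by simp only [mul_assoc]
      _ = e := by rw [hx6, hy1, hy6]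

theorem inv_prop (x : MaximalSubgroup e he) : e * x.2.2.2.choose = x.2.2.2.choose ∧
    x.2.2.2.choose * e = x.2.2.2.choose ∧
    ∃ z : S, e * z = z ∧ z * e = z ∧ x.2.2.2.choose * z = e ∧ z * x.2.2.2.choose = e :=
  ⟨x.2.2.2.choose_spec.1, x.2.2.2.choose_spec.2.1, x.1, x.2.1, x.2.2.1,
    x.2.2.2.choose_spec.2.2.2, x.2.2.2.choose_spec.2.2.1⟩

/-- The group structure: the multiplication is that of `S` and the identity is `e`. -/
noncomputable instance : Group (MaximalSubgroup e he) where
  mul x y := ⟨x.1 * y.1, mul_prop x y⟩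
  one := ⟨e, he, he, e, he, he, he, he⟩
  inv x := ⟨x.2.2.2.choose, inv_prop x⟩
  mul_assoc x y z := Subtype.ext (mul_assoc x.1 y.1 z.1)
  one_mul x := Subtype.ext x.2.1
  mul_one x := Subtype.ext x.2.2.1
  inv_mul_cancel x := Subtype.ext x.2.2.2.choose_spec.2.2.2

end MaximalSubgroup

/-! The Prouhet-Thue-Morse substitution and its `J`-class -/

/-- The two-letter alphabet. -/
inductive Letter : Type
  | a
  | b

/-- The images of the letters: `a` is sent to `ab` and `b` to `ba`. -/
def thueMorseLetter : Letter → FreeSemigroup Letter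
  | .a => FreeSemigroup.of .a * FreeSemigroup.of .b
  | .b => FreeSemigroup.of .b * FreeSemigroup.of .a

/-- The Prouhet-Thue-Morse substitution, an endomorphism of the free semigroup. -/
def thueMorse : FreeSemigroup Letter →ₙ* FreeSemigroup Letter :=
  FreeSemigroup.lift thueMorseLetter

/-- The word `u` is a factor of the word `w`: `w = x u y` for some possibly empty words `x`, `y`
(the empty word is the adjoined identity). -/
def IsFactor {A : Type} (u w : FreeSemigroup A) : Prop :=
  ∃ x y : WithOne (FreeSemigroup A), (w : WithOne (FreeSemigroup A)) = x * u * y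

/-- The language of finite blocks of the Prouhet-Thue-Morse subshift: the factors of the iterated
images of letters. -/
def thueMorseLanguage : Set (FreeSemigroup Letter) :=
  {u | ∃ k : ℕ, 1 ≤ k ∧ ∃ c : Letter, IsFactor u (thueMorse^[k] (FreeSemigroup.of c))}

/-- The `J`-class of the free profinite semigroup associated with the Prouhet-Thue-Morse subshift:
the elements of the topological closure of its language that are not in the language. -/
def thueMorseJ : Set (FreeProfiniteSemigroup Letter) :=
  closure (FreeProfiniteSemigroup.ofWord '' thueMorseLanguage) \
    (FreeProfiniteSemigroup.ofWord '' thueMorseLanguage)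

/-! Ranks -/

/-- The group `G` with a topology has (topological) rank `n`: the smallest number of elements that
generate a dense subgroup is `n`. -/
def HasTopologicalRank (G : Type) [Group G] [TopologicalSpace G] (n : ℕ) : Prop :=
  IsLeast {m : ℕ | ∃ s : Finset G, s.card = m ∧
    Dense ((Subgroup.closure (s : Set G) : Subgroup G) : Set G)} n

/-! The group of order 18 -/

/-- The action of the group of order two on `C₃ × C₃` in which the generator acts by inversion. -/
def inversionAction : Multiplicative (ZMod 2) →*
    MulAut (Multiplicative (ZMod 3) × Multiplicative (ZMod 3)) where
  toFun s := if s = 1 then 1 else MulEquiv.inv _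
  map_one' := if_pos rfl
  map_mul' s t := by
    have h : ∀ s : Multiplicative (ZMod 2), s = 1 ∨ s = Multiplicative.ofAdd 1 := by decide
    have h1 : (Multiplicative.ofAdd (1 : ZMod 2)) ≠ 1 := by decide
    have h2 : (Multiplicative.ofAdd (1 : ZMod 2)) * Multiplicative.ofAdd 1 = 1 := by decide
    rcases h s with rfl | rfl <;> rcases h t with rfl | rfl
    · simp
    · simp [h1]
    · simp [h1]
    · rw [h2, if_pos rfl, if_neg h1]
      ext x <;> simp

/-- The group `(C₃ × C₃) ⋊ C₂` of order 18, in which `C₂` acts by inversion. -/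
abbrev GroupEighteen : Type :=
  (Multiplicative (ZMod 3) × Multiplicative (ZMod 3)) ⋊[inversionAction] Multiplicative (ZMod 2)

/-- This finite group carries the discrete topology. -/
instance groupEighteenTopology : TopologicalSpace GroupEighteen := ⊥

/-! Put lim(w) for the limit of τ^(n!)(w). This exists because, modulo a congruence of finite index,
the iterates of τ on words are eventually periodic, and w ↦ lim(w) is a homomorphism
(`thueMorseLimit`). Modulo such a congruence, lim(a) starts with lim(τ⁴(a)) and lim(b) ends with
lim(τ⁴(b)), up to a further factor.

The word τ⁴(a) contains abab, so s = lim(ab) has the form p s s q in every finite quotient; in a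
finite semigroup this puts s in a subgroup. The identities of these subgroups are compatible and
give an idempotent e. Since aab and abb are also factors of τ⁴(a), the limits of ab, aab and abb all
lie in the maximal subgroup at e (`exists_thueMorse_idempotent`).

Upper bound on the rank: an element of this group is approximated by words of the language which,
modulo a fine congruence, start with τ^K(abb) and end with τ^K(aab). A doubled letter is never the
image of one letter, so it fixes how a word is cut into images; hence such a word is τ^K(m) with m
in a…b (`InThueMorse.exists_eq_iterate`), and has the class of lim(m). Algebraically lim(m) is in
the group generated by the limits of ab, aab and abb (`exists_mem_closure_eq_thueMorseLimit`), so
these three generate a dense subgroup (`dense_closure`).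

Lower bound: label each two-letter block by an element of (C₃ × C₃) ⋊ C₂ and multiply labels along
words. The labels are chosen to be invariant under τ⁴ (`wordLabel_thueMorse_iterate_four`), so
lim(w) has the label of w, and the three generators are sent to a reflection and two independent
translations, which generate. That group acts on the affine plane over the field with three elements
by v ↦ ±v + t; two elements are both translations or preserve a common line, so they never generate
(`GroupEighteen.exists_ne_top_mem`).

Independence of the idempotent: uniform recurrence and compactness make any two elements of J(τ)
multiples of each other (`exists_eq_mul_mul`), and stability turns this into an isomorphism of
maximal subgroups (`nonempty_maximalSubgroup_equiv`). -/

/-! Lists of letters underlying words -/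

namespace FreeSemigroup

variable {A : Type}

/-- The nonempty list of letters of a word. -/
def toList (w : FreeSemigroup A) : List A := w.head :: w.tail

@[simp] theorem toList_mul (u v : FreeSemigroup A) : (u * v).toList = u.toList ++ v.toList := rfl

theorem toList_injective : Function.Injective (toList (A := A)) := by
  rintro ⟨x, l⟩ ⟨y, m⟩ h
  simpa [toList] using h

theorem exists_toList_eq {l : List A} (hl : l ≠ []) : ∃ w : FreeSemigroup A, w.toList = l := by
  cases l with
  | nil => exact absurd rfl hl
  | cons x l => exact ⟨⟨x, l⟩, rfl⟩

end FreeSemigroup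

/-! ### Congruences of finite index -/

namespace FinCon

variable {A : Type}

/-- The intersection of two congruences of finite index. -/
def inf (c d : FinCon A) : FinCon A :=
  ⟨c.1 ⊓ d.1, by
    have := c.2
    have := d.2
    refine Finite.of_injective (fun q : (c.1 ⊓ d.1).Quotient =>
      Con.liftOn (β := c.1.Quotient × d.1.Quotient) q
        (fun w => ((w : c.1.Quotient), (w : d.1.Quotient)))
        fun u v h => Prod.ext ((Con.eq _).2 h.1) ((Con.eq _).2 h.2)) ?_
    intro p q
    induction p, q using Con.induction_on₂ with
    | _ u v =>
      intro h
      exact (Con.eq _).2 ⟨(Con.eq _).1 (congrArg Prod.fst h), (Con.eq _).1 (congrArg Prod.snd h)⟩⟩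

theorem inf_le_left (c d : FinCon A) : (inf c d).1 ≤ c.1 := _root_.inf_le_left

theorem inf_le_right (c d : FinCon A) : (inf c d).1 ≤ d.1 := _root_.inf_le_right

/-- The canonical map between the quotients by two congruences, the first one finer. -/
def proj {c d : FinCon A} (h : c.1 ≤ d.1) : c.1.Quotient →ₙ* d.1.Quotient where
  toFun q := Con.liftOn q (fun w => (w : d.1.Quotient)) fun _ _ huv => (Con.eq _).2 (h huv)
  map_mul' p q := by
    induction p, q using Con.induction_on₂ with
    | _ u v => rfl

@[simp] theorem proj_coe {c d : FinCon A} (h : c.1 ≤ d.1) (w : FreeSemigroup A) :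
    proj h (w : c.1.Quotient) = (w : d.1.Quotient) := rfl

/-- The kernel of a homomorphism onto a finite semigroup. -/
def ker {T : Type} [Semigroup T] [Finite T] (f : FreeSemigroup A →ₙ* T) : FinCon A :=
  ⟨Con.ker f, by
    refine Finite.of_injective (fun q : (Con.ker f).Quotient =>
      Con.liftOn q f fun u v h => (Con.ker_rel f).1 h) ?_
    intro p q
    induction p, q using Con.induction_on₂ with
    | _ u v =>
      intro h
      exact (Con.eq _).2 ((Con.ker_rel f).2 h)⟩

/-- Two words are congruent if they have the same prefix of length `n`. -/
def prefixCon [Finite A] (n : ℕ) : FinCon A :=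
  ⟨{ r := fun u v => u.toList.take n = v.toList.take n
     iseqv := ⟨fun _ => rfl, Eq.symm, Eq.trans⟩
     mul' := by
      intro u u' v v' h h'
      have key : ∀ l m : List A, (l ++ m).take n = (l.take n ++ m.take n).take n := by
        intro l m
        simp only [List.take_append, List.take_take, List.length_take]
        congr 1
        · simp
        · congr 1; omega
      rw [FreeSemigroup.toList_mul, FreeSemigroup.toList_mul, key, h, h', ← key] }, by
    have := (List.finite_length_le A n).to_subtype
    refine Finite.of_injective (β := {l : List A | l.length ≤ n}) (fun q =>
      Con.liftOn q (fun w => ⟨w.toList.take n, by simp⟩) fun u v h => Subtype.ext h) ?_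
    intro p q
    induction p, q using Con.induction_on₂ with
    | _ u v =>
      intro h
      exact (Con.eq _).2 (congrArg Subtype.val h)⟩

/-- Two words are congruent if they have the same suffix of length `n`. -/
def suffixCon [Finite A] (n : ℕ) : FinCon A :=
  ⟨{ r := fun u v => u.toList.reverse.take n = v.toList.reverse.take n
     iseqv := ⟨fun _ => rfl, Eq.symm, Eq.trans⟩
     mul' := by
      intro u u' v v' h h'
      have key : ∀ l m : List A, (l ++ m).take n = (l.take n ++ m.take n).take n := by
        intro l m
        simp only [List.take_append, List.take_take, List.length_take]
        congr 1
        · simp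
        · congr 1; omega
      rw [FreeSemigroup.toList_mul, FreeSemigroup.toList_mul, List.reverse_append,
        List.reverse_append, key, h, h', ← key] }, by
    have := (List.finite_length_le A n).to_subtype
    refine Finite.of_injective (β := {l : List A | l.length ≤ n}) (fun q =>
      Con.liftOn q (fun w => ⟨w.toList.reverse.take n, by simp⟩) fun u v h => Subtype.ext h) ?_
    intro p q
    induction p, q using Con.induction_on₂ with
    | _ u v =>
      intro h
      exact (Con.eq _).2 (congrArg Subtype.val h)⟩

theorem prefixCon_iff [Finite A] {n : ℕ} {u v : FreeSemigroup A} :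
    (u : (prefixCon (A := A) n).1.Quotient) = (v : (prefixCon (A := A) n).1.Quotient) ↔
      u.toList.take n = v.toList.take n := Con.eq _

theorem suffixCon_iff [Finite A] {n : ℕ} {u v : FreeSemigroup A} :
    (u : (suffixCon (A := A) n).1.Quotient) = (v : (suffixCon (A := A) n).1.Quotient) ↔
      u.toList.reverse.take n = v.toList.reverse.take n := Con.eq _

end FinCon

/-! ### Topology of the projective limit -/

namespace FreeProfiniteSemigroup

variable {A : Type}

theorem mul_apply (x y : FreeProfiniteSemigroup A) (c : FinCon A) :
    (x * y).1 c = x.1 c * y.1 c := rfl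

theorem ext_apply {x y : FreeProfiniteSemigroup A} (h : ∀ c, x.1 c = y.1 c) : x = y :=
  Subtype.ext (funext h)

theorem exists_word (x : FreeProfiniteSemigroup A) (c : FinCon A) :
    ∃ w : FreeSemigroup A, x.1 c = (w : c.1.Quotient) := by
  obtain ⟨w, hw⟩ := Quotient.exists_rep (x.1 c)
  exact ⟨w, hw.symm⟩

theorem proj_apply (x : FreeProfiniteSemigroup A) {c d : FinCon A} (h : c.1 ≤ d.1) :
    FinCon.proj h (x.1 c) = x.1 d := by
  obtain ⟨w, hw⟩ := exists_word x c
  rw [x.2 c d h w hw, hw, FinCon.proj_coe]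

theorem apply_eq_of_le {x y : FreeProfiniteSemigroup A} {c d : FinCon A} (h : c.1 ≤ d.1)
    (hxy : x.1 c = y.1 c) : x.1 d = y.1 d := by
  rw [← proj_apply x h, ← proj_apply y h, hxy]

/-- Uniqueness makes the chosen classes compatible. Limits of iterates, group identities and local
inverses are all lifted from the finite quotients in this way. -/
theorem exists_of_unique (P : ∀ c : FinCon A, c.1.Quotient → Prop) (hex : ∀ c, ∃ q, P c q)
    (huniq : ∀ c p q, P c p → P c q → p = q)
    (hmono : ∀ (c d : FinCon A) (h : c.1 ≤ d.1) (q : c.1.Quotient), P c q → P d (FinCon.proj h q)) :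
    ∃ x : FreeProfiniteSemigroup A, ∀ c, P c (x.1 c) := by
  choose q hq using hex
  refine ⟨⟨q, ?_⟩, hq⟩
  intro c d h w hw
  have := hmono c d h _ (hq c)
  rw [hw, FinCon.proj_coe] at this
  exact huniq d _ _ (hq d) this

instance (c : FinCon A) : DiscreteTopology c.1.Quotient := ⟨rfl⟩

theorem continuous_apply (c : FinCon A) :
    Continuous fun x : FreeProfiniteSemigroup A => x.1 c :=
  (_root_.continuous_apply c).comp continuous_subtype_val

theorem isOpen_setOf_apply_eq (c : FinCon A) (q : c.1.Quotient) :
    IsOpen {x : FreeProfiniteSemigroup A | x.1 c = q} :=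
  (isOpen_discrete {q}).preimage (continuous_apply c)

/-- A basic open set of the product restricts finitely many coordinates, and finitely many
congruences have a common refinement of finite index, so one coordinate suffices. -/
theorem exists_apply_eq_subset {U : Set (FreeProfiniteSemigroup A)} (hU : IsOpen U)
    {x : FreeProfiniteSemigroup A} (hx : x ∈ U) :
    ∃ c : FinCon A, ∀ y : FreeProfiniteSemigroup A, y.1 c = x.1 c → y ∈ U := by
  obtain ⟨V, hV, rfl⟩ := isOpen_induced_iff.1 hU
  obtain ⟨I, u, hu, hI⟩ := isOpen_pi_iff.1 hV x.1 hx
  have key : ∀ I : Finset (FinCon A), ∃ c : FinCon A, ∀ d ∈ I, c.1 ≤ d.1 := by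
    intro I
    induction I using Finset.cons_induction with
    | empty => exact ⟨FinCon.ker (T := PUnit) ⟨fun _ => PUnit.unit, fun _ _ => rfl⟩, by simp⟩
    | cons d I hd ih =>
      obtain ⟨c, hc⟩ := ih
      refine ⟨FinCon.inf c d, fun d' hd' => ?_⟩
      rcases Finset.mem_cons.1 hd' with rfl | hd'
      · exact FinCon.inf_le_right _ _
      · exact (FinCon.inf_le_left _ _).trans (hc d' hd')
  obtain ⟨c, hc⟩ := key I
  refine ⟨c, fun y hy => hI fun d hd => ?_⟩
  rw [apply_eq_of_le (hc d hd) hy]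
  exact (hu d hd).2

theorem mem_closure_iff {S : Set (FreeProfiniteSemigroup A)} {x : FreeProfiniteSemigroup A} :
    x ∈ closure S ↔ ∀ c, ∃ y ∈ S, y.1 c = x.1 c := by
  rw [_root_.mem_closure_iff]
  constructor
  · intro h c
    obtain ⟨y, hy, hyS⟩ := h _ (isOpen_setOf_apply_eq c (x.1 c)) rfl
    exact ⟨y, hyS, hy⟩
  · intro h U hU hx
    obtain ⟨c, hc⟩ := exists_apply_eq_subset hU hx
    obtain ⟨y, hyS, hy⟩ := h c
    exact ⟨y, hc y hy, hyS⟩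

theorem mem_closure_ofWord_iff {S : Set (FreeSemigroup A)} {x : FreeProfiniteSemigroup A} :
    x ∈ closure (ofWord '' S) ↔ ∀ c : FinCon A, ∃ w ∈ S, x.1 c = (w : c.1.Quotient) := by
  rw [mem_closure_iff]
  refine forall_congr' fun c => ?_
  constructor
  · rintro ⟨_, ⟨w, hw, rfl⟩, h⟩
    exact ⟨w, hw, h.symm⟩
  · rintro ⟨w, hw, h⟩
    exact ⟨_, ⟨w, hw, rfl⟩, h.symm⟩

theorem continuous_mul : Continuous fun p : FreeProfiniteSemigroup A × FreeProfiniteSemigroup A =>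
    p.1 * p.2 := by
  refine Continuous.subtype_mk (continuous_pi fun c => ?_) _
  exact (continuous_of_discreteTopology (f := fun q : c.1.Quotient × c.1.Quotient => q.1 * q.2)).comp
    (((continuous_apply c).comp continuous_fst).prodMk ((continuous_apply c).comp continuous_snd))

instance : ContinuousMul (FreeProfiniteSemigroup A) := ⟨continuous_mul⟩

instance : CompactSpace (FreeProfiniteSemigroup A) := by
  have : ∀ c : FinCon A, Finite c.1.Quotient := fun c => c.2
  refine isCompact_iff_compactSpace.1 (IsClosed.isCompact ?_)
  change IsClosed {x : ∀ c : FinCon A, c.1.Quotient | ∀ c d : FinCon A, c.1 ≤ d.1 →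
    ∀ w : FreeSemigroup A, x c = (w : c.1.Quotient) → x d = (w : d.1.Quotient)}
  simp only [Set.ofPred_forall]
  refine isClosed_iInter fun c => isClosed_iInter fun d => isClosed_iInter fun _ =>
    isClosed_iInter fun w => ?_
  exact IsClosed.preimage (f := fun x : ∀ c : FinCon A, c.1.Quotient => (x c, x d))
    ((_root_.continuous_apply c).prodMk (_root_.continuous_apply d))
    (isClosed_discrete {p : c.1.Quotient × d.1.Quotient | p.1 = w → p.2 = w})

theorem ofWord_injective [Finite A] : Function.Injective (ofWord (A := A)) := by
  intro u v h
  have h1 := congrFun (congrArg Subtype.val h)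
    (FinCon.prefixCon (u.toList.length + v.toList.length))
  have h2 := FinCon.prefixCon_iff.1 h1
  rw [List.take_of_length_le (by omega), List.take_of_length_le (by omega)] at h2
  exact FreeSemigroup.toList_injective h2

/-- A limit of words that is not a word is a limit of arbitrarily long words. -/
theorem exists_long_word [Finite A] {S : Set (FreeSemigroup A)} {x : FreeProfiniteSemigroup A}
    (hx : x ∈ closure (ofWord '' S) \ ofWord '' S) (n : ℕ) (c : FinCon A) :
    ∃ w ∈ S, x.1 c = (w : c.1.Quotient) ∧ n ≤ w.toList.length := by
  by_contra! hcon
  obtain ⟨hx1, hx2⟩ := hx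
  rw [mem_closure_ofWord_iff] at hx1
  -- If all approximating words were shorter than n, their prefixes of length n would be the words
  -- themselves, so the class modulo `d` would already determine the word and the limit would be
  -- that word.
  set d := FinCon.inf c (FinCon.prefixCon n) with hd
  obtain ⟨v, hvS, hv⟩ := hx1 d
  refine hx2 ⟨v, hvS, ext_apply fun d' => ?_⟩
  obtain ⟨w, hwS, hw⟩ := hx1 (FinCon.inf d d')
  have hw1 : x.1 d = (w : d.1.Quotient) := x.2 _ _ (FinCon.inf_le_left _ _) w hw
  have hw2 : x.1 c = (w : c.1.Quotient) := x.2 _ _ (FinCon.inf_le_left _ _) w hw1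
  have hv2 : x.1 c = (v : c.1.Quotient) := x.2 _ _ (FinCon.inf_le_left _ _) v hv
  have hw3 := x.2 _ _ (FinCon.inf_le_right _ _) w hw1
  have hv3 := x.2 _ _ (FinCon.inf_le_right _ _) v hv
  have := FinCon.prefixCon_iff.1 (hw3.symm.trans hv3)
  have l1 := hcon w hwS hw2
  have l2 := hcon v hvS hv2
  rw [List.take_of_length_le (by omega), List.take_of_length_le (by omega)] at this
  have := FreeSemigroup.toList_injective this
  subst this
  exact (x.2 _ _ (FinCon.inf_le_right _ _) w hw).symm

section Extend

variable {T : Type} [Semigroup T] [Finite T] (f : FreeSemigroup A →ₙ* T)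

/-- The continuous extension of a homomorphism of the free semigroup to a finite semigroup. -/
def extend : FreeProfiniteSemigroup A →ₙ* T where
  toFun x := Con.liftOn (x.1 (FinCon.ker f)) f fun _ _ h => (Con.ker_rel f).1 h
  map_mul' x y := by
    obtain ⟨u, hu⟩ := exists_word x (FinCon.ker f)
    obtain ⟨v, hv⟩ := exists_word y (FinCon.ker f)
    rw [mul_apply, hu, hv]
    exact map_mul f u v

theorem extend_eq {x : FreeProfiniteSemigroup A} {c : FinCon A} (hc : c.1 ≤ Con.ker f)
    {w : FreeSemigroup A} (hw : x.1 c = (w : c.1.Quotient)) : extend f x = f w := by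
  have := x.2 c (FinCon.ker f) hc w hw
  change Con.liftOn (x.1 (FinCon.ker f)) f _ = f w
  rw [this]
  rfl

theorem continuous_extend [TopologicalSpace T] : Continuous (extend f) :=
  (continuous_of_discreteTopology (f := fun q : (FinCon.ker f).1.Quotient =>
    Con.liftOn q f fun _ _ h => (Con.ker_rel f).1 h)).comp (continuous_apply (FinCon.ker f))

end Extend

/-! ### Factorizations of words modulo a congruence -/

/-- Pairs of an element of a semigroup and a set of its factorizations. -/
def Splitting (Q : Type) : Type := Q × Set (Q × Q)

namespace Splitting

variable {Q : Type} [Semigroup Q]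

instance [Finite Q] : Finite (Splitting Q) := inferInstanceAs (Finite (Q × Set (Q × Q)))

/-- A factorization of a product splits the first factor, the second one, or neither. -/
instance : Semigroup (Splitting Q) where
  mul s t := (s.1 * t.1, {p | (∃ q ∈ s.2, p = (q.1, q.2 * t.1)) ∨ p = (s.1, t.1) ∨
    ∃ q ∈ t.2, p = (s.1 * q.1, q.2)})
  mul_assoc r s t := by
    refine Prod.ext (mul_assoc r.1 s.1 t.1) (Set.ext fun p => ?_)
    change (∃ q, ((∃ q' ∈ r.2, q = (q'.1, q'.2 * s.1)) ∨ q = (r.1, s.1) ∨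
        ∃ q' ∈ s.2, q = (r.1 * q'.1, q'.2)) ∧ p = (q.1, q.2 * t.1)) ∨ p = (r.1 * s.1, t.1) ∨
        (∃ q ∈ t.2, p = (r.1 * s.1 * q.1, q.2)) ↔
      (∃ q ∈ r.2, p = (q.1, q.2 * (s.1 * t.1))) ∨ p = (r.1, s.1 * t.1) ∨
        ∃ q, ((∃ q' ∈ s.2, q = (q'.1, q'.2 * t.1)) ∨ q = (s.1, t.1) ∨
          ∃ q' ∈ t.2, q = (s.1 * q'.1, q'.2)) ∧ p = (r.1 * q.1, q.2)
    constructor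
    · rintro (⟨_, ⟨q, hq, rfl⟩ | rfl | ⟨q, hq, rfl⟩, rfl⟩ | rfl | ⟨q, hq, rfl⟩)
      · exact Or.inl ⟨q, hq, by simp [mul_assoc]⟩
      · exact Or.inr (Or.inl rfl)
      · exact Or.inr (Or.inr ⟨_, Or.inl ⟨q, hq, rfl⟩, rfl⟩)
      · exact Or.inr (Or.inr ⟨_, Or.inr (Or.inl rfl), rfl⟩)
      · exact Or.inr (Or.inr ⟨_, Or.inr (Or.inr ⟨q, hq, rfl⟩), by simp [mul_assoc]⟩)
    · rintro (⟨q, hq, rfl⟩ | rfl | ⟨_, ⟨q, hq, rfl⟩ | rfl | ⟨q, hq, rfl⟩, rfl⟩)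
      · exact Or.inl ⟨_, Or.inl ⟨q, hq, rfl⟩, by simp [mul_assoc]⟩
      · exact Or.inl ⟨_, Or.inr (Or.inl rfl), rfl⟩
      · exact Or.inl ⟨_, Or.inr (Or.inr ⟨q, hq, rfl⟩), rfl⟩
      · exact Or.inr (Or.inl rfl)
      · exact Or.inr (Or.inr ⟨q, hq, by simp [mul_assoc]⟩)

theorem mul_def (s t : Splitting Q) : s * t =
    (s.1 * t.1, {p | (∃ q ∈ s.2, p = (q.1, q.2 * t.1)) ∨ p = (s.1, t.1) ∨
      ∃ q ∈ t.2, p = (s.1 * q.1, q.2)}) := rfl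

end Splitting

/-- The homomorphism that records the factorizations of a word up to a congruence. -/
def splitting (c : FinCon A) : FreeSemigroup A →ₙ* Splitting c.1.Quotient :=
  FreeSemigroup.lift fun x => ((FreeSemigroup.of x : FreeSemigroup A), ∅)

theorem splitting_fst (c : FinCon A) (w : FreeSemigroup A) : (splitting c w).1 = w := by
  induction w using FreeSemigroup.recOnMul with
  | ih1 x => rfl
  | ih2 x v _ hv =>
    rw [map_mul, Splitting.mul_def]
    simp only [hv]
    rfl

theorem exists_split (c : FinCon A) (w : FreeSemigroup A) :
    ∀ p ∈ (splitting c w).2, ∃ u v : FreeSemigroup A, w = u * v ∧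
      p = ((u : c.1.Quotient), (v : c.1.Quotient)) := by
  induction w using FreeSemigroup.recOnMul with
  | ih1 x => intro p hp; exact absurd hp (Set.notMem_empty p)
  | ih2 x v hx hv =>
    intro p hp
    rw [map_mul, Splitting.mul_def] at hp
    rcases hp with ⟨q, hq, rfl⟩ | rfl | ⟨q, hq, rfl⟩
    · obtain ⟨u, v', rfl', rfl⟩ := hx q hq
      exact ⟨u, v' * v, by rw [rfl', mul_assoc], by rw [splitting_fst]; rfl⟩
    · exact ⟨_, _, rfl, by rw [splitting_fst, splitting_fst]⟩
    · obtain ⟨u, v', rfl', rfl⟩ := hv q hq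
      exact ⟨FreeSemigroup.of x * u, v', by rw [rfl', mul_assoc], by rw [splitting_fst]; rfl⟩

/-- The closure of a prefix-closed language is prefix-closed. -/
theorem mem_closure_of_mul_mem {S : Set (FreeSemigroup A)}
    (hS : ∀ u v : FreeSemigroup A, u * v ∈ S → u ∈ S) {x y : FreeProfiniteSemigroup A}
    (h : x * y ∈ closure (ofWord '' S)) : x ∈ closure (ofWord '' S) := by
  rw [mem_closure_ofWord_iff] at h ⊢
  intro c
  have := c.2
  -- The kernel of `splitting c` remembers all factorizations modulo `c`. A word of S with the class
  -- of x * y therefore splits into two words whose classes modulo `c` are those of x and y.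
  set d := FinCon.ker (splitting c)
  obtain ⟨w, hwS, hw⟩ := h d
  obtain ⟨u, hu⟩ := exists_word x (FinCon.inf c d)
  obtain ⟨v, hv⟩ := exists_word y (FinCon.inf c d)
  have hw' : splitting c w = splitting c u * splitting c v := by
    rw [← extend_eq (splitting c) (c := d) le_rfl hw, map_mul,
      extend_eq (splitting c) (FinCon.inf_le_right c d) hu,
      extend_eq (splitting c) (FinCon.inf_le_right c d) hv]
  have hmem : ((u : c.1.Quotient), (v : c.1.Quotient)) ∈ (splitting c w).2 := by
    rw [hw', Splitting.mul_def]
    exact Or.inr (Or.inl (by rw [splitting_fst, splitting_fst]))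
  obtain ⟨u', v', rfl, h'⟩ := exists_split c w _ hmem
  refine ⟨u', hS _ _ hwS, ?_⟩
  exact (x.2 _ _ (FinCon.inf_le_left c d) u hu).trans (congrArg Prod.fst h')

end FreeProfiniteSemigroup

/-! Finite semigroups -/

section FiniteSemigroup

/-- Iteration gives s = pᵏ s (sq)ᵏ. Periodicity of the powers of sq turns this into s = s s a, hence
s = sᵏ s aᵏ, and periodicity of the powers of s then gives the claim. -/
theorem exists_pow_succ_eq_of_eq_mul {M : Type} [Monoid M] [Finite M] {p s q : M}
    (h : s = p * s * s * q) : ∃ n : ℕ, 1 ≤ n ∧ s ^ (n + 1) = s := by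
  have h1 : ∀ k : ℕ, p ^ k * s * (s * q) ^ k = s := by
    intro k
    induction k with
    | zero => simp
    | succ k ih =>
      calc p ^ (k + 1) * s * (s * q) ^ (k + 1) = p ^ k * (p * s * s * q) * (s * q) ^ k := by
            rw [pow_succ p, pow_succ' (s * q)]; simp only [mul_assoc]
        _ = s := by rw [← h, ih]
  have cyc : ∀ t : M, ∃ i m : ℕ, 1 ≤ m ∧ t ^ (m + i) = t ^ i := by
    intro t
    obtain ⟨i, j, hij, h⟩ := Finite.exists_ne_map_eq_of_infinite fun k : ℕ => t ^ k
    rcases lt_or_gt_of_ne hij with hlt | hlt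
    · exact ⟨i, j - i, by omega, by rw [Nat.sub_add_cancel hlt.le]; exact h.symm⟩
    · exact ⟨j, i - j, by omega, by rw [Nat.sub_add_cancel hlt.le]; exact h⟩
  have h2 : ∃ a, s = s * s * a := by
    obtain ⟨i, m, hm, him⟩ := cyc (s * q)
    obtain ⟨m, rfl⟩ : ∃ k, m = k + 1 := ⟨m - 1, by omega⟩
    refine ⟨q * (s * q) ^ m, ?_⟩
    calc s = p ^ i * s * (s * q) ^ (m + 1 + i) := by rw [him, h1]
      _ = (p ^ i * s * (s * q) ^ i) * (s * q) ^ (m + 1) := by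
        rw [add_comm, pow_add]; simp only [mul_assoc]
      _ = s * s * (q * (s * q) ^ m) := by rw [h1, pow_succ']; simp only [mul_assoc]
  obtain ⟨a, ha⟩ := h2
  have h3 : ∀ k : ℕ, s ^ k * s * a ^ k = s := by
    intro k
    induction k with
    | zero => simp
    | succ k ih =>
      calc s ^ (k + 1) * s * a ^ (k + 1) = s ^ k * (s * s * a) * a ^ k := by
            rw [pow_succ, pow_succ']; simp only [mul_assoc]
        _ = s := by rw [← ha, ih]
  obtain ⟨i, m, hm, him⟩ := cyc s
  refine ⟨m, hm, ?_⟩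
  calc s ^ (m + 1) = s ^ m * (s ^ i * s * a ^ i) := by rw [h3, pow_succ]
    _ = s ^ (m + i) * s * a ^ i := by rw [pow_add]; simp only [mul_assoc]
    _ = s := by rw [him, h3]

variable {Q : Type} [Semigroup Q]

/-- The element `e` is the identity of a subgroup that contains `s`. -/
def IsGroupIdentity (s e : Q) : Prop :=
  e * e = e ∧ e * s = s ∧ s * e = s ∧ ∃ y, s * y = e ∧ y * s = e

/-- The element `y` is the inverse of `x` in the local monoid of `e`. -/
def IsLocalInverse (e x y : Q) : Prop :=
  e * y = y ∧ y * e = y ∧ x * y = e ∧ y * x = e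

theorem IsGroupIdentity.unique {s e f : Q} (he : IsGroupIdentity s e) (hf : IsGroupIdentity s f) :
    e = f := by
  obtain ⟨-, he2, he3, y, he4, he5⟩ := he
  obtain ⟨-, hf2, hf3, z, hf4, hf5⟩ := hf
  have h1 : e * f = e := by rw [← he5, mul_assoc, hf3]
  have h2 : e * f = f := by rw [← hf4, ← mul_assoc, he2]
  exact h1.symm.trans h2

theorem IsLocalInverse.unique {e x y z : Q} (hy : IsLocalInverse e x y)
    (hz : IsLocalInverse e x z) : y = z := by
  rw [← hy.2.1, ← hz.2.2.1, ← mul_assoc, hy.2.2.2, hz.1]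

theorem IsGroupIdentity.map {R : Type} [Semigroup R] (f : Q →ₙ* R) {s e : Q}
    (h : IsGroupIdentity s e) : IsGroupIdentity (f s) (f e) := by
  obtain ⟨h1, h2, h3, y, h4, h5⟩ := h
  exact ⟨by rw [← map_mul, h1], by rw [← map_mul, h2], by rw [← map_mul, h3], f y,
    by rw [← map_mul, h4], by rw [← map_mul, h5]⟩

theorem IsLocalInverse.map {R : Type} [Semigroup R] (f : Q →ₙ* R) {e x y : Q}
    (h : IsLocalInverse e x y) : IsLocalInverse (f e) (f x) (f y) := by
  obtain ⟨h1, h2, h3, h4⟩ := h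
  exact ⟨by rw [← map_mul, h1], by rw [← map_mul, h2], by rw [← map_mul, h3],
    by rw [← map_mul, h4]⟩

/-- In a finite semigroup, an element of the form `p s² q` lies in a subgroup if it equals `s`; the
identity of the subgroup is a multiple of `s²`. -/
theorem exists_isGroupIdentity [Finite Q] {p s q : Q} (h : s = p * s * s * q) :
    ∃ e, IsGroupIdentity s e ∧ ∃ r, e = s * r := by
  have : Finite (WithOne Q) := inferInstanceAs (Finite (Option Q))
  have h' : (s : WithOne Q) = (p : WithOne Q) * s * s * q := by
    rw [← WithOne.coe_mul, ← WithOne.coe_mul, ← WithOne.coe_mul, ← h]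
  obtain ⟨n, hn, hs⟩ := exists_pow_succ_eq_of_eq_mul h'
  have hpow : ∀ k : ℕ, ∃ r : Q, (r : WithOne Q) = (s : WithOne Q) ^ (k + 1) := by
    intro k
    induction k with
    | zero => exact ⟨s, by simp⟩
    | succ k ih =>
      obtain ⟨r, hr⟩ := ih
      exact ⟨r * s, by rw [WithOne.coe_mul, hr, ← pow_succ]⟩
  have hper : ∀ k : ℕ, 1 ≤ k → (s : WithOne Q) ^ (n + k) = (s : WithOne Q) ^ k := by
    intro k hk
    obtain ⟨k, rfl⟩ : ∃ j, k = j + 1 := ⟨k - 1, by omega⟩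
    rw [← add_assoc, add_right_comm, pow_add, hs, ← pow_succ']
  obtain ⟨n, rfl⟩ : ∃ k, n = k + 1 := ⟨n - 1, by omega⟩
  obtain ⟨e, he⟩ := hpow n
  -- With N = n + 1 and e = s^N, the inverse of s is taken as s^(2N-1) and not s^(N-1), whose
  -- exponent could be 0 and would then leave the semigroup.
  obtain ⟨y, hy⟩ := hpow (n + n)
  have hinj := WithOne.coe_injective (α := Q)
  have hsy : s * y = e := hinj (by
    rw [WithOne.coe_mul, hy, he, ← pow_succ', ← hper (n + 1) (by omega)]
    congr 1; omega)
  refine ⟨e, ⟨hinj ?_, hinj ?_, hinj ?_, y, hsy, hinj ?_⟩, y, hsy.symm⟩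
  · rw [WithOne.coe_mul, he, ← pow_add, hper _ (by omega)]
  · rw [WithOne.coe_mul, he, ← pow_succ, hs]
  · rw [WithOne.coe_mul, he, ← pow_succ', hs]
  · rw [WithOne.coe_mul, hy, he, ← pow_succ, ← hper (n + 1) (by omega)]
    congr 1; omega

/-- One-sided inverses in the local monoids of a finite semigroup are two-sided. -/
theorem mul_eq_idempotent_symm [Finite Q] {f a b : Q} (hf : f * f = f)
    (hb : f * b = b) (ha' : a * f = a) (hab : a * b = f) : b * a = f := by
  -- Left multiplication by b on fQ is injective because a undoes it, so by finiteness it is onto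
  -- and f has a preimage, which must be a.
  let β : {x : Q // f * x = x} → {x : Q // f * x = x} := fun x =>
    ⟨b * x.1, by rw [← mul_assoc, hb]⟩
  have hβ : Function.Injective β := by
    intro x y hxy
    have := congrArg (a * ·) (congrArg Subtype.val hxy)
    simp only [β, ← mul_assoc, hab] at this
    rw [x.2, y.2] at this
    exact Subtype.ext this
  obtain ⟨x, hx⟩ := Finite.surjective_of_injective hβ ⟨f, hf⟩
  have hx' : b * x.1 = f := congrArg Subtype.val hx
  have : x.1 = a :=
    calc x.1 = f * x.1 := x.2.symm
      _ = a * b * x.1 := congrArg (· * x.1) hab.symm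
      _ = a := by rw [mul_assoc, hx', ha']
  rw [← this, hx']

/-- In the local monoid of `e`, an element of which `e` is a multiple is invertible. -/
theorem exists_isLocalInverse [Finite Q] {e x p q : Q} (he : e * e = e) (hx : e * x = x)
    (hx' : x * e = x) (h : p * x * q = e) : ∃ y, IsLocalInverse e x y := by
  -- Once p and q are moved into the local monoid of e, two uses of one-sided implies two-sided
  -- apply: the first gives x a right inverse, the second makes it two-sided.
  have h1 : (e * p * e) * (x * (e * q * e)) = e := by
    calc (e * p * e) * (x * (e * q * e)) = e * (p * (e * x * e) * q) * e := by
          simp only [mul_assoc]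
      _ = e := by rw [hx, hx', h, he, he]
  have h2 := mul_eq_idempotent_symm he (a := e * p * e) (b := x * (e * q * e))
    (by simp only [← mul_assoc, hx]) (by simp only [mul_assoc, he]) h1
  have h3 : x * (e * q * e * (e * p * e)) = e := by rw [← mul_assoc, h2]
  have h4 := mul_eq_idempotent_symm he (a := x) (b := e * q * e * (e * p * e))
    (by simp only [← mul_assoc, he]) hx' h3
  exact ⟨_, by simp only [← mul_assoc, he], by simp only [mul_assoc, he], h3, h4⟩

end FiniteSemigroup

/-! Maximal subgroups -/

namespace MaximalSubgroup

variable {S : Type} [Semigroup S] {e f : S} {he : e * e = e} {hf : f * f = f}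

theorem coe_mul (x y : MaximalSubgroup e he) : (x * y).1 = x.1 * y.1 := rfl

theorem coe_one : (1 : MaximalSubgroup e he).1 = e := rfl

theorem mul_inv_coe (x : MaximalSubgroup e he) : x.1 * (x⁻¹).1 = e := by
  rw [← coe_mul, mul_inv_cancel, coe_one]

theorem inv_mul_coe (x : MaximalSubgroup e he) : (x⁻¹).1 * x.1 = e := by
  rw [← coe_mul, inv_mul_cancel, coe_one]

theorem one_mul_coe (x : MaximalSubgroup e he) : e * x.1 = x.1 := x.2.1

theorem mul_one_coe (x : MaximalSubgroup e he) : x.1 * e = x.1 := x.2.2.1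

/-- An element with a local inverse is in the maximal subgroup. -/
theorem exists_coe_eq {x y : S} (hx : e * x = x) (hx' : x * e = x) (h : IsLocalInverse e x y) :
    ∃ g : MaximalSubgroup e he, g.1 = x :=
  ⟨⟨x, hx, hx', y, h⟩, rfl⟩

/-- The maximal subgroups of two idempotents in the same `D`-class are isomorphic. -/
def conjEquiv [TopologicalSpace S] [ContinuousMul S] {s t : S} (hst : s * t = e) (hts : t * s = f)
    (hs : e * s = s) (hs' : s * f = s) (ht : f * t = t) (ht' : t * e = t) :
    MaximalSubgroup e he ≃ₜ* MaximalSubgroup f hf where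
  toFun x := ⟨t * x.1 * s, by rw [← mul_assoc, ← mul_assoc, ht], by rw [mul_assoc, hs'],
    t * (x⁻¹).1 * s, by rw [← mul_assoc, ← mul_assoc, ht], by rw [mul_assoc, hs'], by
      calc t * x.1 * s * (t * (x⁻¹).1 * s) = t * (x.1 * (s * t) * (x⁻¹).1) * s := by
            simp only [mul_assoc]
        _ = f := by rw [hst, mul_one_coe, mul_inv_coe, ht', hts], by
      calc t * (x⁻¹).1 * s * (t * x.1 * s) = t * ((x⁻¹).1 * (s * t) * x.1) * s := by
            simp only [mul_assoc]
        _ = f := by rw [hst, mul_one_coe, inv_mul_coe, ht', hts]⟩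
  invFun x := ⟨s * x.1 * t, by rw [← mul_assoc, ← mul_assoc, hs], by rw [mul_assoc, ht'],
    s * (x⁻¹).1 * t, by rw [← mul_assoc, ← mul_assoc, hs], by rw [mul_assoc, ht'], by
      calc s * x.1 * t * (s * (x⁻¹).1 * t) = s * (x.1 * (t * s) * (x⁻¹).1) * t := by
            simp only [mul_assoc]
        _ = e := by rw [hts, mul_one_coe, mul_inv_coe, hs', hst], by
      calc s * (x⁻¹).1 * t * (s * x.1 * t) = s * ((x⁻¹).1 * (t * s) * x.1) * t := by
            simp only [mul_assoc]
        _ = e := by rw [hts, mul_one_coe, inv_mul_coe, hs', hst]⟩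
  left_inv x := Subtype.ext (by
    change s * (t * x.1 * s) * t = x.1
    calc s * (t * x.1 * s) * t = (s * t) * x.1 * (s * t) := by simp only [mul_assoc]
      _ = x.1 := by rw [hst, one_mul_coe, mul_one_coe])
  right_inv x := Subtype.ext (by
    change t * (s * x.1 * t) * s = x.1
    calc t * (s * x.1 * t) * s = (t * s) * x.1 * (t * s) := by simp only [mul_assoc]
      _ = x.1 := by rw [hts, one_mul_coe, mul_one_coe])
  map_mul' x y := Subtype.ext (by
    change t * (x.1 * y.1) * s = t * x.1 * s * (t * y.1 * s)
    calc t * (x.1 * y.1) * s = t * (x.1 * (s * t) * y.1) * s := by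
          rw [hst, mul_one_coe]
      _ = _ := by simp only [mul_assoc])
  continuous_toFun := Continuous.subtype_mk
    ((continuous_const.mul continuous_subtype_val).mul continuous_const) _
  continuous_invFun := Continuous.subtype_mk
    ((continuous_const.mul continuous_subtype_val).mul continuous_const) _

end MaximalSubgroup

/-! ### Topological rank under homomorphisms -/

section Rank

variable {G H : Type} [Group G] [TopologicalSpace G] [Group H] [TopologicalSpace H]

theorem exists_dense_closure_of_surjective (f : G →* H) (hf : Continuous f)
    (hs : Function.Surjective f) {s : Finset G}
    (h : Dense ((Subgroup.closure (s : Set G) : Subgroup G) : Set G)) :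
    ∃ t : Finset H, t.card ≤ s.card ∧
      Dense ((Subgroup.closure (t : Set H) : Subgroup H) : Set H) := by
  classical
  refine ⟨s.image f, Finset.card_image_le, ?_⟩
  rw [Finset.coe_image, ← MonoidHom.map_closure, Subgroup.coe_map]
  exact hs.denseRange.dense_image hf h

theorem HasTopologicalRank.of_continuousMulEquiv (φ : G ≃ₜ* H) {n : ℕ}
    (h : HasTopologicalRank G n) : HasTopologicalRank H n := by
  have key : ∀ {G H : Type} [Group G] [TopologicalSpace G] [Group H] [TopologicalSpace H]
      (_ : G ≃ₜ* H) {m : ℕ}, (∃ s : Finset G, s.card = m ∧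
        Dense ((Subgroup.closure (s : Set G) : Subgroup G) : Set G)) →
      ∃ s : Finset H, s.card = m ∧
        Dense ((Subgroup.closure (s : Set H) : Subgroup H) : Set H) := by
    classical
    rintro G H _ _ _ _ φ m ⟨s, hs, hd⟩
    refine ⟨s.image φ, by rw [Finset.card_image_of_injective _ φ.injective, hs], ?_⟩
    rw [Finset.coe_image, show (φ : G → H) '' s = (φ.toMulEquiv.toMonoidHom) '' s from rfl,
      ← MonoidHom.map_closure, Subgroup.coe_map]
    exact φ.surjective.denseRange.dense_image φ.continuous hd
  exact ⟨key φ h.1, fun m hm => h.2 (key φ.symm hm)⟩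

end Rank

/-! ### Lifting subgroups from the finite quotients -/

namespace FreeProfiniteSemigroup

variable {A : Type}

theorem exists_isGroupIdentity {s : FreeProfiniteSemigroup A}
    (h : ∀ c : FinCon A, ∃ e, IsGroupIdentity (s.1 c) e) :
    ∃ e : FreeProfiniteSemigroup A, e * e = e ∧ ∀ c, IsGroupIdentity (s.1 c) (e.1 c) := by
  obtain ⟨e, he⟩ := exists_of_unique (fun c q => IsGroupIdentity (s.1 c) q) h
    (fun c p q hp hq => hp.unique hq) (fun c d hcd q hq => by
      rw [← proj_apply s hcd]; exact hq.map _)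
  exact ⟨e, ext_apply fun c => (he c).1, he⟩

theorem exists_isLocalInverse {e x : FreeProfiniteSemigroup A}
    (h : ∀ c : FinCon A, ∃ y, IsLocalInverse (e.1 c) (x.1 c) y) :
    ∃ y, IsLocalInverse e x y := by
  obtain ⟨y, hy⟩ := exists_of_unique (fun c q => IsLocalInverse (e.1 c) (x.1 c) q) h
    (fun c p q hp hq => hp.unique hq) (fun c d hcd q hq => by
      rw [← proj_apply e hcd, ← proj_apply x hcd]; exact hq.map _)
  exact ⟨y, ext_apply fun c => (hy c).1, ext_apply fun c => (hy c).2.1,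
    ext_apply fun c => (hy c).2.2.1, ext_apply fun c => (hy c).2.2.2⟩

/-- Two idempotents that are multiples of each other have isomorphic maximal subgroups. -/
theorem nonempty_maximalSubgroup_equiv {e f p q p' q' : FreeProfiniteSemigroup A}
    (he : e * e = e) (hf : f * f = f) (hef : e = p * f * q) (hfe : f = p' * e * q') :
    Nonempty (MaximalSubgroup e he ≃ₜ* MaximalSubgroup f hf) := by
  have hst : (e * p * f) * (f * q * e) = e := by
    calc (e * p * f) * (f * q * e) = e * (p * (f * f) * q) * e := by simp only [mul_assoc]
      _ = e := by rw [hf, ← hef, he, he]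
  have hts : (f * q * e) * (e * p * f) = f := by
    obtain ⟨s, hs⟩ : ∃ s, s = e * p * f := ⟨_, rfl⟩
    obtain ⟨t, ht⟩ : ∃ t, t = f * q * e := ⟨_, rfl⟩
    rw [← hs, ← ht] at hst ⊢
    have hsf : s * f = s := by rw [hs, mul_assoc, hf]
    have hft : f * t = t := by rw [ht, ← mul_assoc, ← mul_assoc, hf]
    have hte : t * e = t := by rw [ht, mul_assoc, he]
    have hg : (t * s) * (t * s) = t * s := by
      calc (t * s) * (t * s) = t * (s * t) * s := by simp only [mul_assoc]
        _ = t * s := by rw [hst, hte]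
    have hxy : (f * p' * s) * ((t * s) * (t * q' * f)) = f := by
      calc (f * p' * s) * ((t * s) * (t * q' * f)) = f * (p' * ((s * t) * (s * t)) * q') * f := by
            simp only [mul_assoc]
        _ = f := by rw [hst, he, ← hfe, hf, hf]
    -- Stability, checked in each finite quotient, reverses the product. Then f is a left multiple
    -- by the idempotent t s, which gives t s f = f, while t s f = t s holds anyway.
    have hyx : ((t * s) * (t * q' * f)) * (f * p' * s) = f := by
      refine ext_apply fun c => ?_
      have := c.2
      exact mul_eq_idempotent_symm (f := f.1 c) (a := (f * p' * s).1 c)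
        (b := ((t * s) * (t * q' * f)).1 c)
        (by rw [← mul_apply, hf])
        (by rw [← mul_apply]; simp only [← mul_assoc, hft])
        (by rw [← mul_apply, mul_assoc, hsf]) (by rw [← mul_apply, hxy])
    calc t * s = (t * s) * f := by rw [mul_assoc, hsf]
      _ = ((t * s) * (t * s)) * (t * q' * f) * (f * p' * s) :=
        (congrArg (t * s * ·) hyx.symm).trans (by simp only [mul_assoc])
      _ = f := by rw [hg, hyx]
  exact ⟨MaximalSubgroup.conjEquiv hst hts (by simp only [← mul_assoc, he])
    (by simp only [mul_assoc, hf]) (by simp only [← mul_assoc, hf])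
    (by simp only [mul_assoc, he])⟩

end FreeProfiniteSemigroup

/-! The Prouhet-Thue-Morse substitution on lists of letters -/

namespace Letter

instance : DecidableEq Letter
  | a, a => isTrue rfl
  | b, b => isTrue rfl
  | a, b => isFalse (nofun)
  | b, a => isFalse (nofun)

instance : Fintype Letter := ⟨{a, b}, fun x => by cases x <;> decide⟩

/-- The other letter. -/
def other : Letter → Letter
  | a => b
  | b => a

theorem other_ne (x : Letter) : x.other ≠ x := by cases x <;> decide

end Letter

/-- The Prouhet-Thue-Morse substitution on lists. -/
def thueMorseList : List Letter → List Letter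
  | [] => []
  | x :: l => x :: x.other :: thueMorseList l

namespace thueMorseList

theorem append (l m : List Letter) :
    thueMorseList (l ++ m) = thueMorseList l ++ thueMorseList m := by
  induction l with
  | nil => rfl
  | cons x l ih => simp [thueMorseList, ih]

theorem iterate_append (n : ℕ) (l m : List Letter) :
    thueMorseList^[n] (l ++ m) = thueMorseList^[n] l ++ thueMorseList^[n] m := by
  induction n with
  | zero => rfl
  | succ n ih => simp only [Function.iterate_succ_apply', ih, append]

theorem length_eq (l : List Letter) : (thueMorseList l).length = 2 * l.length := by
  induction l with
  | nil => rfl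
  | cons x l ih => simp only [thueMorseList, List.length_cons, ih]; ring

theorem injective : Function.Injective thueMorseList := by
  intro l m h
  induction l generalizing m with
  | nil => cases m with
    | nil => rfl
    | cons y m => simp [thueMorseList] at h
  | cons x l ih => cases m with
    | nil => simp [thueMorseList] at h
    | cons y m =>
      simp only [thueMorseList, List.cons.injEq] at h
      rw [h.1, ih h.2.2]

theorem prefix_of_prefix {l m : List Letter} (h : thueMorseList l <+: thueMorseList m) :
    l <+: m := by
  induction l generalizing m with
  | nil => exact List.nil_prefix
  | cons x l ih => cases m with
    | nil => simp [thueMorseList] at h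
    | cons y m =>
      simp only [thueMorseList, List.cons_prefix_cons] at h ⊢
      exact ⟨h.1, ih h.2.2⟩

theorem suffix_of_suffix {l m : List Letter} (h : thueMorseList l <:+ thueMorseList m) :
    l <:+ m := by
  obtain ⟨r, hr⟩ := h
  have hlen := congrArg List.length hr
  rw [List.length_append, length_eq, length_eq] at hlen
  have h1 : m = m.take (m.length - l.length) ++ m.drop (m.length - l.length) :=
    (List.take_append_drop _ _).symm
  rw [h1, append] at hr
  have h2 := (List.append_inj' hr (by rw [length_eq, length_eq, List.length_drop]; omega)).2
  rw [injective h2]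
  exact List.drop_suffix _ _

theorem prefix_map {l m : List Letter} (h : l <+: m) : thueMorseList l <+: thueMorseList m := by
  obtain ⟨r, rfl⟩ := h
  exact ⟨_, (append _ _).symm⟩

theorem suffix_map {l m : List Letter} (h : l <:+ m) : thueMorseList l <:+ thueMorseList m := by
  obtain ⟨r, rfl⟩ := h
  exact ⟨_, (append _ _).symm⟩

theorem infix_map {l m : List Letter} (h : l <:+: m) : thueMorseList l <:+: thueMorseList m := by
  obtain ⟨r, s, rfl⟩ := h
  exact ⟨_, _, by rw [append, append]⟩

theorem iterate_prefix_map (n : ℕ) {l m : List Letter} (h : l <+: m) :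
    thueMorseList^[n] l <+: thueMorseList^[n] m := by
  obtain ⟨r, rfl⟩ := h
  exact ⟨_, (iterate_append _ _ _).symm⟩

theorem iterate_suffix_map (n : ℕ) {l m : List Letter} (h : l <:+ m) :
    thueMorseList^[n] l <:+ thueMorseList^[n] m := by
  obtain ⟨r, rfl⟩ := h
  exact ⟨_, (iterate_append _ _ _).symm⟩

theorem iterate_infix_map (n : ℕ) {l m : List Letter} (h : l <:+: m) :
    thueMorseList^[n] l <:+: thueMorseList^[n] m := by
  obtain ⟨r, s, rfl⟩ := h
  exact ⟨_, _, by rw [iterate_append, iterate_append]⟩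

/-- A prefix of an image cuts it between the images of two letters or inside one of them. -/
theorem eq_append {m p r : List Letter} (h : thueMorseList m = p ++ r) :
    (∃ m₁ m₂, m = m₁ ++ m₂ ∧ p = thueMorseList m₁ ∧ r = thueMorseList m₂) ∨
    ∃ m₁ x m₂, m = m₁ ++ x :: m₂ ∧ p = thueMorseList m₁ ++ [x] ∧
      r = x.other :: thueMorseList m₂ := by
  induction m generalizing p with
  | nil =>
    obtain ⟨rfl, rfl⟩ := List.append_eq_nil_iff.1 h.symm
    exact Or.inl ⟨[], [], rfl, rfl, rfl⟩
  | cons x m ih =>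
    match p with
    | [] => exact Or.inl ⟨[], x :: m, rfl, rfl, h.symm⟩
    | [y] =>
      simp only [thueMorseList, List.cons_append, List.nil_append, List.cons.injEq] at h
      obtain ⟨rfl, rfl⟩ := h
      exact Or.inr ⟨[], x, m, rfl, rfl, rfl⟩
    | y :: z :: p =>
      simp only [thueMorseList, List.cons_append, List.cons.injEq] at h
      obtain ⟨rfl, rfl, h⟩ := h
      rcases ih h with ⟨m₁, m₂, rfl, rfl, rfl⟩ | ⟨m₁, w, m₂, rfl, rfl, rfl⟩
      · exact Or.inl ⟨x :: m₁, m₂, rfl, rfl, rfl⟩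
      · exact Or.inr ⟨x :: m₁, w, m₂, rfl, rfl, rfl⟩

/-- A factor of an image is the image of a factor, up to one letter at each end. -/
theorem exists_of_infix {l m : List Letter} (h : l <:+: thueMorseList m) :
    ∃ s m' p, m' <:+: m ∧ l = s ++ thueMorseList m' ++ p ∧ s.length ≤ 1 ∧ p.length ≤ 1 := by
  obtain ⟨r, t, h⟩ := h
  rw [List.append_assoc] at h
  have key : ∀ {l' m₂ : List Letter}, thueMorseList m₂ = l' ++ t →
      ∃ m' p, m' <:+: m₂ ∧ l' = thueMorseList m' ++ p ∧ p.length ≤ 1 := by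
    intro l' m₂ h
    rcases eq_append h with ⟨m₃, m₄, rfl, rfl, -⟩ | ⟨m₃, x, m₄, rfl, rfl, -⟩
    · exact ⟨m₃, [], ⟨[], m₄, rfl⟩, by simp, by simp⟩
    · exact ⟨m₃, [x], ⟨[], x :: m₄, rfl⟩, rfl, by simp⟩
  rcases eq_append h.symm with ⟨m₁, m₂, rfl, -, h2⟩ | ⟨m₁, x, m₂, rfl, -, h2⟩
  · obtain ⟨m', p, hm, rfl, hp⟩ := key h2.symm
    exact ⟨[], m', p, hm.trans ⟨m₁, [], by simp⟩, rfl, by simp, hp⟩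
  · cases l with
    | nil => exact ⟨[], [], [], List.nil_infix, rfl, by simp, by simp⟩
    | cons y l =>
      rw [List.cons_append, List.cons.injEq] at h2
      obtain ⟨m', p, hm, rfl, hp⟩ := key h2.2.symm
      exact ⟨[y], m', p, hm.trans ⟨m₁ ++ [x], [], by simp⟩, rfl, by simp, hp⟩

theorem not_prefix_repeat (x : Letter) (m p : List Letter) (hp : p.length ≤ 1) :
    ¬ [x, x] <+: thueMorseList m ++ p := by
  intro h
  cases m with
  | nil =>
    have := h.length_le
    simp [thueMorseList] at this
    omega
  | cons y m =>
    simp only [thueMorseList, List.cons_append, List.cons_prefix_cons] at h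
    exact Letter.other_ne y (h.2.1.symm.trans h.1)

theorem not_suffix_repeat (x : Letter) (m : List Letter) : ¬ [x, x] <:+ thueMorseList m := by
  intro h
  rcases List.eq_nil_or_concat m with rfl | ⟨m, y, rfl⟩
  · have := h.length_le
    simp [thueMorseList] at this
  · rw [List.concat_eq_append, append] at h
    obtain ⟨r, hr⟩ := h
    have := (List.append_inj' hr rfl).2
    simp only [thueMorseList, List.cons.injEq] at this
    exact Letter.other_ne y (this.2.1.symm.trans this.1)

/-- A factor of an image that starts with `xyy` and ends with `zzt` is an image. -/
theorem exists_eq_of_infix {l m : List Letter} (h : l <:+: thueMorseList m) {x y z t : Letter}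
    (h1 : [x, y, y] <+: l) (h2 : [z, z, t] <:+ l) :
    ∃ m', m' <:+: m ∧ l = thueMorseList m' := by
  obtain ⟨s, m', p, hm, rfl, hs, hp⟩ := exists_of_infix h
  -- With a leftover first letter, the pair yy would start an image followed by at most one letter,
  -- but an image starts with two different letters.
  have hs' : s = [] := by
    match s, hs with
    | [], _ => rfl
    | [w], _ =>
      simp only [List.cons_append, List.nil_append, List.cons_prefix_cons (a := x)] at h1
      exact absurd h1.2 (not_prefix_repeat y m' p hp)
  subst hs'
  have hp' : p = [] := by
    match p, hp with
    | [], _ => rfl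
    | [w], _ =>
      obtain ⟨r, hr⟩ := h2
      rw [show r ++ [z, z, t] = (r ++ [z, z]) ++ [t] by simp, List.nil_append] at hr
      exact absurd ⟨r, (List.append_inj' hr rfl).1⟩ (not_suffix_repeat z m')
  subst hp'
  exact ⟨m', hm, by simp⟩

theorem iterate_prefix_abb (n : ℕ) :
    [Letter.a, Letter.b, Letter.b] <+: thueMorseList^[n] [Letter.a, Letter.b, Letter.b] := by
  induction n with
  | zero => exact List.prefix_rfl
  | succ n ih =>
    rw [Function.iterate_succ_apply']
    exact List.IsPrefix.trans ⟨[.a, .b, .a], rfl⟩ (prefix_map ih)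

/-- Since τ(x x x̄) ends with x̄ x̄ x, the shape persists while the two letters are exchanged at
each application. -/
theorem iterate_suffix_aab (n : ℕ) : ∃ x y : Letter,
    [x, x, y] <:+ thueMorseList^[n] [Letter.a, Letter.a, Letter.b] := by
  have : ∃ x : Letter, [x, x, x.other] <:+ thueMorseList^[n] [Letter.a, Letter.a, Letter.b] := by
    induction n with
    | zero => exact ⟨.a, List.suffix_rfl⟩
    | succ n ih =>
      obtain ⟨x, hx⟩ := ih
      refine ⟨x.other, ?_⟩
      rw [Function.iterate_succ_apply']
      refine List.IsSuffix.trans ?_ (suffix_map hx)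
      cases x
      · exact ⟨[.a, .b, .a], rfl⟩
      · exact ⟨[.b, .a, .b], rfl⟩
  obtain ⟨x, hx⟩ := this
  exact ⟨x, _, hx⟩

end thueMorseList

/-! ### The language, recognizability and uniform recurrence -/

/-- The language of the Prouhet-Thue-Morse subshift as a property of lists. -/
def InThueMorse (l : List Letter) : Prop :=
  ∃ (k : ℕ) (x : Letter), l <:+: thueMorseList^[k] [x]

namespace InThueMorse

open thueMorseList

theorem of_infix {l m : List Letter} (h : l <:+: m) (hm : InThueMorse m) : InThueMorse l := by
  obtain ⟨k, x, hx⟩ := hm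
  exact ⟨k, x, h.trans hx⟩

theorem exists_infix_thueMorseList {l : List Letter} (h : InThueMorse l) :
    ∃ m, InThueMorse m ∧ l <:+: thueMorseList m := by
  obtain ⟨k, x, hx⟩ := h
  refine ⟨thueMorseList^[k] [x], ⟨k, x, List.infix_rfl⟩, ?_⟩
  rw [← Function.iterate_succ_apply' thueMorseList, Function.iterate_succ_apply]
  exact hx.trans (iterate_infix_map k ⟨[], [x.other], rfl⟩)

/-- Recognizability of the iterated substitution. -/
theorem exists_eq_iterate (n : ℕ) {l : List Letter} (h : InThueMorse l)
    (h1 : thueMorseList^[n] [.a, .b, .b] <+: l) (h2 : thueMorseList^[n] [.a, .a, .b] <:+ l) :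
    ∃ m, l = thueMorseList^[n] m ∧ [.a, .b, .b] <+: m ∧ [.a, .a, .b] <:+ m := by
  induction n generalizing l with
  | zero => exact ⟨l, rfl, h1, h2⟩
  | succ n ih =>
    obtain ⟨m, hm, hl⟩ := exists_infix_thueMorseList h
    obtain ⟨x, y, hxy⟩ := iterate_suffix_aab (n + 1)
    obtain ⟨m', hm', rfl⟩ :=
      exists_eq_of_infix hl ((iterate_prefix_abb (n + 1)).trans h1) (hxy.trans h2)
    rw [Function.iterate_succ_apply'] at h1 h2
    obtain ⟨m'', rfl, h3, h4⟩ := ih (of_infix hm' hm) (prefix_of_prefix h1) (suffix_of_suffix h2)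
    exact ⟨m'', (Function.iterate_succ_apply' _ _ _).symm, h3, h4⟩

/-- Long words of the language contain iterated images of letters. -/
theorem exists_length_iterate_infix (n : ℕ) : ∃ N : ℕ, ∀ l, InThueMorse l → N ≤ l.length →
    ∃ x, thueMorseList^[n] [x] <:+: l := by
  induction n with
  | zero =>
    refine ⟨1, fun l _ hl => ?_⟩
    cases l with
    | nil => simp at hl
    | cons x l => exact ⟨x, [], l, rfl⟩
  | succ n ih =>
    obtain ⟨N, hN⟩ := ih
    refine ⟨2 * N + 2, fun l hl hlen => ?_⟩
    obtain ⟨m, hm, hlm⟩ := exists_infix_thueMorseList hl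
    obtain ⟨s, m', p, hm', rfl, hs, hp⟩ := exists_of_infix hlm
    rw [List.length_append, List.length_append, length_eq] at hlen
    obtain ⟨x, hx⟩ := hN m' (of_infix hm' hm) (by omega)
    refine ⟨x, ?_⟩
    rw [Function.iterate_succ_apply']
    exact (infix_map hx).trans ⟨s, p, rfl⟩

/-- Uniform recurrence: long words of the language contain a given word in their interior. -/
theorem exists_length_infix {l : List Letter} (hl : InThueMorse l) : ∃ N : ℕ, ∀ m, InThueMorse m →
    N ≤ m.length → ∃ p q, p ≠ [] ∧ q ≠ [] ∧ m = p ++ l ++ q := by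
  obtain ⟨k, x, r, s, hrs⟩ := hl
  obtain ⟨N, hN⟩ := exists_length_iterate_infix (k + 3)
  refine ⟨N, fun m hm hlen => ?_⟩
  obtain ⟨y, p, q, rfl⟩ := hN m hm hlen
  have hne : ∀ z : Letter, thueMorseList^[k] [z] ≠ [] := by
    intro z hz
    have : ∀ n, (thueMorseList^[n] [z]).length = 2 ^ n := by
      intro n
      induction n with
      | zero => rfl
      | succ n ih => rw [Function.iterate_succ_apply', length_eq, ih, pow_succ']
    have := this k
    rw [hz] at this
    exact (Nat.two_pow_pos k).ne this
  -- The third iterate is used because τ³ of either letter contains both letters strictly inside;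
  -- its first and last letters provide the nonempty margins.
  have h3 : ∃ (z : Letter) (u v : List Letter),
      thueMorseList^[3] [y] = z :: u ++ [x] ++ v ++ [z.other] := by
    cases x <;> cases y
    · exact ⟨.a, [.b, .b, .a, .b], [.a], rfl⟩
    · exact ⟨.b, [.a], [.b, .a, .b, .b], rfl⟩
    · exact ⟨.a, [.b], [.a, .b, .a, .a], rfl⟩
    · exact ⟨.b, [.a, .a, .b, .a], [.b], rfl⟩
  obtain ⟨z, u, v, h3⟩ := h3
  have h4 : thueMorseList^[k + 3] [y] = thueMorseList^[k] [z] ++ thueMorseList^[k] u ++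
      (r ++ l ++ s) ++ thueMorseList^[k] v ++ thueMorseList^[k] [z.other] := by
    rw [Function.iterate_add_apply, h3, hrs]
    simp only [← iterate_append]
    rfl
  refine ⟨p ++ (thueMorseList^[k] [z] ++ thueMorseList^[k] u ++ r),
    s ++ thueMorseList^[k] v ++ thueMorseList^[k] [z.other] ++ q, ?_, ?_, ?_⟩
  · simp [hne]
  · simp [hne]
  · rw [h4]; simp only [List.append_assoc]

end InThueMorse

theorem toList_thueMorse (w : FreeSemigroup Letter) :
    (thueMorse w).toList = thueMorseList w.toList := by
  induction w using FreeSemigroup.recOnMul with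
  | ih1 x => cases x <;> rfl
  | ih2 x y hx hy =>
    rw [map_mul, FreeSemigroup.toList_mul, hx, hy, FreeSemigroup.toList_mul, thueMorseList.append]

theorem toList_thueMorse_iterate (n : ℕ) (w : FreeSemigroup Letter) :
    (thueMorse^[n] w).toList = thueMorseList^[n] w.toList := by
  induction n with
  | zero => rfl
  | succ n ih => rw [Function.iterate_succ_apply', Function.iterate_succ_apply', toList_thueMorse, ih]

theorem isFactor_iff {A : Type} {u w : FreeSemigroup A} :
    IsFactor u w ↔ u.toList <:+: w.toList := by
  have hinj := WithOne.coe_injective (α := FreeSemigroup A)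
  constructor
  · rintro ⟨x, y, h⟩
    induction x with
    | one => induction y with
      | one =>
        rw [one_mul, mul_one] at h
        rw [hinj h]
      | coe y =>
        rw [one_mul, ← WithOne.coe_mul] at h
        rw [hinj h]
        exact ⟨[], y.toList, rfl⟩
    | coe x => induction y with
      | one =>
        rw [mul_one, ← WithOne.coe_mul] at h
        rw [hinj h]
        exact ⟨x.toList, [], by simp⟩
      | coe y =>
        rw [← WithOne.coe_mul, ← WithOne.coe_mul] at h
        rw [hinj h]
        exact ⟨x.toList, y.toList, rfl⟩
  · rintro ⟨p, q, h⟩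
    have key : ∀ l : List A, ∃ x : WithOne (FreeSemigroup A),
        (l = [] ∧ x = 1) ∨ ∃ v : FreeSemigroup A, v.toList = l ∧ x = v := by
      intro l
      rcases eq_or_ne l [] with hl | hl
      · exact ⟨1, Or.inl ⟨hl, rfl⟩⟩
      · obtain ⟨v, hv⟩ := FreeSemigroup.exists_toList_eq hl
        exact ⟨v, Or.inr ⟨v, hv, rfl⟩⟩
    obtain ⟨x, hx⟩ := key p
    obtain ⟨y, hy⟩ := key q
    refine ⟨x, y, ?_⟩
    rcases hx with ⟨rfl, rfl⟩ | ⟨x, rfl, rfl⟩ <;> rcases hy with ⟨rfl, rfl⟩ | ⟨y, rfl, rfl⟩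
    · rw [one_mul, mul_one, FreeSemigroup.toList_injective (a₁ := u) (a₂ := w) (by simpa using h)]
    · rw [one_mul, ← WithOne.coe_mul,
        FreeSemigroup.toList_injective (a₁ := u * y) (a₂ := w) (by simpa using h)]
    · rw [mul_one, ← WithOne.coe_mul,
        FreeSemigroup.toList_injective (a₁ := x * u) (a₂ := w) (by simpa using h)]
    · rw [← WithOne.coe_mul, ← WithOne.coe_mul,
        FreeSemigroup.toList_injective (a₁ := x * u * y) (a₂ := w) (by simpa using h)]

theorem mem_thueMorseLanguage_iff {w : FreeSemigroup Letter} :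
    w ∈ thueMorseLanguage ↔ InThueMorse w.toList := by
  constructor
  · rintro ⟨k, -, x, h⟩
    rw [isFactor_iff, toList_thueMorse_iterate] at h
    exact ⟨k, x, h⟩
  · rintro ⟨k, x, h⟩
    refine ⟨k + 1, by omega, x, ?_⟩
    rw [isFactor_iff, toList_thueMorse_iterate, Function.iterate_succ_apply]
    exact h.trans (thueMorseList.iterate_infix_map k ⟨[], [x.other], rfl⟩)

/-! Limits of iterates of the substitution -/

/-- The number `K` is a period of the iteration of the substitution up to the congruence `c`. -/
def IsThueMorsePeriod (c : FinCon Letter) (K : ℕ) : Prop :=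
  -- The factor 8 makes K a multiple of 4, for the invariance of labels, and forces K ≥ 8, so that K
  -- - 4 is even and positive and τ⁴ can be split off.
  8 ∣ K ∧ 0 < K ∧ ∀ j, 1 ≤ j → ∀ w : FreeSemigroup Letter,
    ((thueMorse^[j * K] w : FreeSemigroup Letter) : c.1.Quotient) =
      ((thueMorse^[K] w : FreeSemigroup Letter) : c.1.Quotient)

namespace IsThueMorsePeriod

theorem mono {c d : FinCon Letter} (h : c.1 ≤ d.1) {K : ℕ} (hK : IsThueMorsePeriod c K) :
    IsThueMorsePeriod d K :=
  ⟨hK.1, hK.2.1, fun j hj w => (Con.eq _).2 (h ((Con.eq _).1 (hK.2.2 j hj w)))⟩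

theorem mul_left {c : FinCon Letter} {K : ℕ} (hK : IsThueMorsePeriod c K) {i : ℕ} (hi : 1 ≤ i) :
    IsThueMorsePeriod c (i * K) :=
  ⟨hK.1.mul_left i, Nat.mul_pos hi hK.2.1, fun j hj w => by
    rw [← mul_assoc, hK.2.2 _ (Nat.mul_pos hj hi), hK.2.2 i hi]⟩

end IsThueMorsePeriod

/-- Modulo `c`, an iterate of τ is determined by the classes of the images of the two letters. There
are finitely many pairs of classes, so the sequence of iterates is eventually periodic. -/
theorem exists_isThueMorsePeriod (c : FinCon Letter) : ∃ K, IsThueMorsePeriod c K := by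
  have := c.2
  have key : ∃ i m : ℕ, 1 ≤ m ∧ ∀ w : FreeSemigroup Letter,
      ((thueMorse^[i] w : FreeSemigroup Letter) : c.1.Quotient) =
        ((thueMorse^[i + m] w : FreeSemigroup Letter) : c.1.Quotient) := by
    have ext : ∀ i j : ℕ, (∀ x, ((thueMorse^[i] (.of x) : FreeSemigroup Letter) : c.1.Quotient) =
          ((thueMorse^[j] (.of x) : FreeSemigroup Letter) : c.1.Quotient)) →
        ∀ w, ((thueMorse^[i] w : FreeSemigroup Letter) : c.1.Quotient) =
          ((thueMorse^[j] w : FreeSemigroup Letter) : c.1.Quotient) := by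
      intro i j h w
      induction w using FreeSemigroup.recOnMul with
      | ih1 x => exact h x
      | ih2 x y hx hy =>
        rw [iterate_map_mul, iterate_map_mul, Con.coe_mul, Con.coe_mul, hx, hy]
    obtain ⟨i, j, hij, h⟩ := Finite.exists_ne_map_eq_of_infinite fun (n : ℕ) (x : Letter) =>
      ((thueMorse^[n] (.of x) : FreeSemigroup Letter) : c.1.Quotient)
    have h' := ext i j fun x => congrFun h x
    rcases lt_or_gt_of_ne hij with hlt | hlt
    · exact ⟨i, j - i, by omega, fun w => by rw [Nat.add_sub_cancel' hlt.le]; exact h' w⟩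
    · exact ⟨j, i - j, by omega, fun w => by rw [Nat.add_sub_cancel' hlt.le]; exact (h' w).symm⟩
  obtain ⟨i, m, hm, h⟩ := key
  have h1 : ∀ n k w, ((thueMorse^[i + n + k * m] w : FreeSemigroup Letter) : c.1.Quotient) =
      ((thueMorse^[i + n] w : FreeSemigroup Letter) : c.1.Quotient) := by
    intro n k w
    induction k with
    | zero => simp
    | succ k ih =>
      rw [← ih, show i + n + (k + 1) * m = i + m + (n + k * m) by ring,
        Function.iterate_add_apply, ← h, ← Function.iterate_add_apply, add_assoc]
  -- A multiple of 8 and of the period m that is at least the preperiod i.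
  refine ⟨8 * m * (i + 1), ⟨m * (i + 1), by ring⟩, by positivity, fun j hj w => ?_⟩
  obtain ⟨j, rfl⟩ : ∃ k, j = k + 1 := ⟨j - 1, by omega⟩
  have hle : i ≤ 8 * m * (i + 1) := by nlinarith
  obtain ⟨n, hn⟩ := Nat.exists_eq_add_of_le hle
  rw [show (j + 1) * (8 * m * (i + 1)) = 8 * m * (i + 1) + (j * 8 * (i + 1)) * m by ring, hn, h1]

namespace FreeProfiniteSemigroup

theorem exists_thueMorseLimit (w : FreeSemigroup Letter) : ∃ x : FreeProfiniteSemigroup Letter,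
    ∀ c, ∃ K, IsThueMorsePeriod c K ∧ x.1 c = (thueMorse^[K] w : FreeSemigroup Letter) := by
  refine exists_of_unique (fun c q => ∃ K, IsThueMorsePeriod c K ∧
    q = (thueMorse^[K] w : FreeSemigroup Letter)) ?_ ?_ ?_
  · intro c
    obtain ⟨K, hK⟩ := exists_isThueMorsePeriod c
    exact ⟨_, K, hK, rfl⟩
  · rintro c p q ⟨K, hK, rfl⟩ ⟨K', hK', rfl⟩
    -- Two periods K and K' give the same class, since both agree with the iterate of order K K'.
    rw [← hK.2.2 K' hK'.2.1, ← hK'.2.2 K hK.2.1, mul_comm]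
  · rintro c d h q ⟨K, hK, rfl⟩
    exact ⟨K, hK.mono h, rfl⟩

/-- The limit of the images of a word under the iterates `τ^(n!)` of the substitution. -/
noncomputable def thueMorseLimit : FreeSemigroup Letter →ₙ* FreeProfiniteSemigroup Letter where
  toFun w := (exists_thueMorseLimit w).choose
  map_mul' u v := ext_apply fun c => by
    obtain ⟨K, hK, h⟩ := (exists_thueMorseLimit (u * v)).choose_spec c
    obtain ⟨K', hK', h'⟩ := (exists_thueMorseLimit u).choose_spec c
    obtain ⟨K'', hK'', h''⟩ := (exists_thueMorseLimit v).choose_spec c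
    rw [mul_apply, h, h', h'', iterate_map_mul, Con.coe_mul]
    congr 1
    · rw [← hK.2.2 K' hK'.2.1, ← hK'.2.2 K hK.2.1, mul_comm]
    · rw [← hK.2.2 K'' hK''.2.1, ← hK''.2.2 K hK.2.1, mul_comm]

theorem thueMorseLimit_apply {c : FinCon Letter} {K : ℕ} (hK : IsThueMorsePeriod c K)
    (w : FreeSemigroup Letter) :
    (thueMorseLimit w).1 c = (thueMorse^[K] w : FreeSemigroup Letter) := by
  obtain ⟨K', hK', h⟩ := (exists_thueMorseLimit w).choose_spec c
  refine h.trans ?_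
  rw [← hK.2.2 K' hK'.2.1, ← hK'.2.2 K hK.2.1, mul_comm]

theorem thueMorseLimit_iterate {c : FinCon Letter} {K : ℕ} (hK : IsThueMorsePeriod c K)
    (w : FreeSemigroup Letter) :
    (thueMorseLimit (thueMorse^[K] w)).1 c = (thueMorseLimit w).1 c := by
  rw [thueMorseLimit_apply hK, thueMorseLimit_apply hK, ← Function.iterate_add_apply,
    ← hK.2.2 2 (by omega), two_mul]

end FreeProfiniteSemigroup

theorem exists_thueMorse_iterate_a (n : ℕ) :
    ∃ r, thueMorse^[n + 1] (.of .a) = FreeSemigroup.of .a * r := by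
  induction n with
  | zero => exact ⟨.of .b, rfl⟩
  | succ n ih =>
    obtain ⟨r, hr⟩ := ih
    rw [Function.iterate_succ_apply', hr, map_mul]
    exact ⟨.of .b * thueMorse r, by rw [← mul_assoc]; rfl⟩

/-- Each application of τ changes the last letter, so only even iterates of b end with b; τ²(b) =
baab. -/
theorem exists_thueMorse_iterate_b (n : ℕ) :
    ∃ r, thueMorse^[2 * (n + 1)] (.of .b) = r * FreeSemigroup.of .b := by
  induction n with
  | zero => exact ⟨⟨.b, [.a, .a]⟩, rfl⟩
  | succ n ih =>
    obtain ⟨r, hr⟩ := ih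
    rw [show 2 * (n + 1 + 1) = 2 + 2 * (n + 1) by ring, Function.iterate_add_apply, hr,
      iterate_map_mul]
    exact ⟨thueMorse^[2] r * ⟨.b, [.a, .a]⟩, by rw [mul_assoc]; rfl⟩

namespace FreeProfiniteSemigroup

/-- The limit of the images of `a` starts with the limit of the images of `τ⁴(a)`. -/
theorem exists_thueMorseLimit_a (c : FinCon Letter) : ∃ z, (thueMorseLimit (.of .a)).1 c =
    (thueMorseLimit (thueMorse^[4] (.of .a))).1 c * z := by
  obtain ⟨K, hK⟩ := exists_isThueMorsePeriod c
  obtain ⟨n, hn⟩ : ∃ n, K = 4 + (n + 1) := ⟨K - 5, by have := hK.1; have := hK.2.1; omega⟩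
  obtain ⟨r, hr⟩ := exists_thueMorse_iterate_a n
  refine ⟨(thueMorseLimit (thueMorse^[4] r)).1 c, ?_⟩
  rw [← thueMorseLimit_iterate hK, hn, Function.iterate_add_apply, hr, iterate_map_mul, map_mul,
    mul_apply]

/-- The limit of the images of `b` ends with the limit of the images of `τ⁴(b)`. -/
theorem exists_thueMorseLimit_b (c : FinCon Letter) : ∃ z, (thueMorseLimit (.of .b)).1 c =
    z * (thueMorseLimit (thueMorse^[4] (.of .b))).1 c := by
  obtain ⟨K, hK⟩ := exists_isThueMorsePeriod c
  obtain ⟨n, hn⟩ : ∃ n, K = 4 + 2 * (n + 1) :=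
    ⟨(K - 6) / 2, by have := hK.1; have := hK.2.1; omega⟩
  obtain ⟨r, hr⟩ := exists_thueMorse_iterate_b n
  refine ⟨(thueMorseLimit (thueMorse^[4] r)).1 c, ?_⟩
  rw [← thueMorseLimit_iterate hK, hn, Function.iterate_add_apply, hr, iterate_map_mul, map_mul,
    mul_apply]

/-- Places lim(ab) in the ideal generated by lim(w) for each factor w strictly inside τ⁴(a); this is
the input of both stability arguments for the maximal subgroup. -/
theorem exists_thueMorseLimit_ab_eq {p w q : FreeSemigroup Letter}
    (h : thueMorse^[4] (.of .a) = p * w * q) (c : FinCon Letter) :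
    ∃ p' q', (thueMorseLimit ⟨.a, [.b]⟩).1 c = p' * (thueMorseLimit w).1 c * q' := by
  obtain ⟨z, hz⟩ := exists_thueMorseLimit_a c
  refine ⟨(thueMorseLimit p).1 c,
    (thueMorseLimit q).1 c * (z * (thueMorseLimit (.of .b)).1 c), ?_⟩
  rw [show (⟨.a, [.b]⟩ : FreeSemigroup Letter) = .of .a * .of .b from rfl, map_mul, mul_apply, hz,
    h, map_mul, map_mul, mul_apply, mul_apply]
  simp only [mul_assoc]

/-- The maximal subgroup that contains the limits of the images of `ab`, `aab` and `abb`. -/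
theorem exists_thueMorse_idempotent : ∃ (e : FreeProfiniteSemigroup Letter) (he : e * e = e)
    (x y z : MaximalSubgroup e he), x.1 = thueMorseLimit ⟨.a, [.b]⟩ ∧
      y.1 = thueMorseLimit ⟨.a, [.a, .b]⟩ ∧ z.1 = thueMorseLimit ⟨.a, [.b, .b]⟩ ∧
      e * thueMorseLimit (.of .a) = thueMorseLimit (.of .a) := by
  have hid : ∀ c : FinCon Letter, ∃ e, IsGroupIdentity ((thueMorseLimit ⟨.a, [.b]⟩).1 c) e ∧
      ∃ r, e = (thueMorseLimit ⟨.a, [.b]⟩).1 c * r := by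
    intro c
    have := c.2
    -- The decomposition τ⁴(a) = abbabaabba · abab · ba exhibits the square of ab.
    obtain ⟨p, q, h⟩ := exists_thueMorseLimit_ab_eq (p := ⟨.a, [.b, .b, .a, .b, .a, .a, .b, .b, .a]⟩)
      (w := ⟨.a, [.b]⟩ * ⟨.a, [.b]⟩) (q := ⟨.b, [.a]⟩) rfl c
    rw [map_mul, mul_apply, ← mul_assoc] at h
    exact _root_.exists_isGroupIdentity h
  obtain ⟨e, he, hec⟩ := exists_isGroupIdentity fun c => (hid c).imp fun _ h => h.1
  -- Because τ⁴(a) starts with ab and τ⁴(b) ends with ab, the identity e fixes lim(a) on the left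
  -- and lim(b) on the right, so e is a two-sided identity for lim(w) whenever w starts with a and
  -- ends with b.
  have ha : e * thueMorseLimit (.of .a) = thueMorseLimit (.of .a) := ext_apply fun c => by
    obtain ⟨z, hz⟩ := exists_thueMorseLimit_a c
    rw [show thueMorse^[4] (.of .a) = (⟨.a, [.b]⟩ : FreeSemigroup Letter) *
      ⟨.b, [.a, .b, .a, .a, .b, .b, .a, .a, .b, .a, .b, .b, .a]⟩ from rfl, map_mul, mul_apply] at hz
    rw [mul_apply, hz, ← mul_assoc, ← mul_assoc, (hec c).2.1]
  have hb : thueMorseLimit (.of .b) * e = thueMorseLimit (.of .b) := ext_apply fun c => by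
    obtain ⟨z, hz⟩ := exists_thueMorseLimit_b c
    rw [show thueMorse^[4] (.of .b) =
      (⟨.b, [.a, .a, .b, .a, .b, .b, .a, .a, .b, .b, .a, .b, .a]⟩ : FreeSemigroup Letter) *
      ⟨.a, [.b]⟩ from rfl, map_mul, mul_apply] at hz
    rw [mul_apply, hz, mul_assoc, mul_assoc, (hec c).2.2.1]
  have hmem : ∀ w r r' : FreeSemigroup Letter, w = .of .a * r → w = r' * .of .b →
      (∃ p q, thueMorse^[4] (.of .a) = p * w * q) →
      ∃ g : MaximalSubgroup e he, g.1 = thueMorseLimit w := by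
    rintro w r r' hr hr' ⟨p, q, hpq⟩
    have h1 : e * thueMorseLimit w = thueMorseLimit w := by rw [hr, map_mul, ← mul_assoc, ha]
    have h2 : thueMorseLimit w * e = thueMorseLimit w := by rw [hr', map_mul, mul_assoc, hb]
    obtain ⟨y, hy⟩ := exists_isLocalInverse (e := e) (x := thueMorseLimit w) fun c => by
      have := c.2
      obtain ⟨p', q', h⟩ := exists_thueMorseLimit_ab_eq hpq c
      obtain ⟨hc1, -, -, y, hc2, -⟩ := hec c
      refine _root_.exists_isLocalInverse hc1 (by rw [← mul_apply, h1]) (by rw [← mul_apply, h2])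
        (p := p') (q := q' * y) ?_
      rw [← mul_assoc, ← h, hc2]
    exact MaximalSubgroup.exists_coe_eq h1 h2 hy
  obtain ⟨x, hx⟩ := hmem ⟨.a, [.b]⟩ ⟨.b, []⟩ ⟨.a, []⟩ rfl rfl
    ⟨⟨.a, [.b, .b]⟩, ⟨.a, [.a, .b, .b, .a, .a, .b, .a, .b, .b, .a]⟩, rfl⟩
  obtain ⟨y, hy⟩ := hmem ⟨.a, [.a, .b]⟩ ⟨.a, [.b]⟩ ⟨.a, [.a]⟩ rfl rfl
    ⟨⟨.a, [.b, .b, .a, .b, .a, .a, .b, .b]⟩, ⟨.a, [.b, .b, .a]⟩, rfl⟩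
  obtain ⟨z, hz⟩ := hmem ⟨.a, [.b, .b]⟩ ⟨.b, [.b]⟩ ⟨.a, [.b]⟩ rfl rfl
    ⟨⟨.a, [.b, .b, .a, .b, .a]⟩, ⟨.a, [.a, .b, .a, .b, .b, .a]⟩, rfl⟩
  exact ⟨e, he, x, y, z, hx, hy, hz, ha⟩

theorem prefix_mem_thueMorseLanguage (u v : FreeSemigroup Letter) (h : u * v ∈ thueMorseLanguage) :
    u ∈ thueMorseLanguage := by
  rw [mem_thueMorseLanguage_iff] at h ⊢
  exact h.of_infix ⟨[], v.toList, rfl⟩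

theorem thueMorseLimit_ab_mem_closure :
    thueMorseLimit ⟨.a, [.b]⟩ ∈ closure (ofWord '' thueMorseLanguage) := by
  rw [mem_closure_ofWord_iff]
  intro c
  obtain ⟨K, hK⟩ := exists_isThueMorsePeriod c
  refine ⟨_, ?_, thueMorseLimit_apply hK _⟩
  rw [mem_thueMorseLanguage_iff, toList_thueMorse_iterate]
  exact ⟨K + 1, .a, by rw [Function.iterate_succ_apply]; exact List.infix_rfl⟩

/-! ### Generators of the maximal subgroup -/

section Idempotent

variable {e : FreeProfiniteSemigroup Letter} {he : e * e = e} {x y z : MaximalSubgroup e he}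

theorem idempotent_ne_ofWord (he : e * e = e) (w : FreeSemigroup Letter) : ofWord w ≠ e := by
  rintro rfl
  have := congrArg FreeSemigroup.length (ofWord_injective (a₁ := w * w) (a₂ := w) he)
  rw [FreeSemigroup.length_mul, FreeSemigroup.length] at this
  omega

theorem idempotent_mem_thueMorseJ (hx : x.1 = thueMorseLimit ⟨.a, [.b]⟩) : e ∈ thueMorseJ := by
  refine ⟨mem_closure_of_mul_mem prefix_mem_thueMorseLanguage (y := x.1) ?_, ?_⟩
  · rw [x.one_mul_coe, hx]
    exact thueMorseLimit_ab_mem_closure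
  · rintro ⟨w, -, hw⟩
    exact idempotent_ne_ofWord he w hw

/-- The limits of the images of the words that start with `a` and end with `b` are generated by
three of them. -/
theorem exists_mem_closure_eq_thueMorseLimit (hx : x.1 = thueMorseLimit ⟨.a, [.b]⟩)
    (hy : y.1 = thueMorseLimit ⟨.a, [.a, .b]⟩) (hz : z.1 = thueMorseLimit ⟨.a, [.b, .b]⟩)
    (ha : e * thueMorseLimit (.of .a) = thueMorseLimit (.of .a)) {l : List Letter}
    (hl : [.b] <:+ Letter.a :: l) :
    ∃ g ∈ Subgroup.closure ({x, y, z} : Set (MaximalSubgroup e he)),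
      g.1 = thueMorseLimit ⟨.a, l⟩ := by
  set u := thueMorseLimit (.of .a) with hu
  set v := thueMorseLimit (.of .b) with hv
  set H := Subgroup.closure ({x, y, z} : Set (MaximalSubgroup e he)) with hH
  have hxH : x ∈ H := Subgroup.subset_closure (by simp)
  have hyH : y ∈ H := Subgroup.subset_closure (by simp)
  have hzH : z ∈ H := Subgroup.subset_closure (by simp)
  have hx' : u * v = x.1 := by rw [hx, hu, hv, ← map_mul]; rfl
  have hy' : u * x.1 = y.1 := by rw [← hx', hy, hu, hv, ← map_mul, ← map_mul]; rfl
  have hz' : x.1 * v = z.1 := by rw [← hx', hz, hu, hv, ← map_mul, ← map_mul]; rfl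
  have hxu : ∀ t : FreeProfiniteSemigroup Letter, t * u * v * (x⁻¹).1 * u = t * u := by
    intro t
    calc t * u * v * (x⁻¹).1 * u = t * ((u * v) * (x⁻¹).1 * u) := by simp only [mul_assoc]
      _ = t * u := by rw [hx', x.mul_inv_coe, ha]
  -- With u = lim(a) and v = lim(b), the limit of a word ending with a is not tracked as a group
  -- element; its product with v is tracked, together with the identity that recovers the limit from
  -- this product.
  have key : ∀ l : List Letter,
      ([.b] <:+ Letter.a :: l ∧ ∃ g ∈ H, g.1 = thueMorseLimit ⟨.a, l⟩) ∨
      (¬ [.b] <:+ Letter.a :: l ∧ (∃ g ∈ H, g.1 = thueMorseLimit ⟨.a, l⟩ * v) ∧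
        thueMorseLimit ⟨.a, l⟩ * v * (x⁻¹).1 * u = thueMorseLimit ⟨.a, l⟩) := by
    intro l
    induction l using List.reverseRecOn with
    | nil =>
      refine Or.inr ⟨by decide, ⟨x, hxH, hx'.symm⟩, ?_⟩
      change u * v * (x⁻¹).1 * u = u
      rw [hx', x.mul_inv_coe, ha]
    | append_singleton l t ih =>
      have hw : thueMorseLimit ⟨.a, l ++ [t]⟩ = thueMorseLimit ⟨.a, l⟩ * thueMorseLimit (.of t) := by
        rw [← map_mul]; rfl
      cases t with
      | a =>
        refine Or.inr ⟨?_, ?_, by rw [hw]; exact hxu _⟩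
        · rintro ⟨r, hr⟩
          have := (List.append_inj' (hr.trans (List.cons_append (a := Letter.a)).symm) rfl).2
          exact absurd this (by decide)
        · rcases ih with ⟨-, g, hg, hgw⟩ | ⟨-, ⟨g, hg, hgw⟩, h⟩
          · refine ⟨g * x, mul_mem hg hxH, ?_⟩
            rw [MaximalSubgroup.coe_mul, hgw, hw, mul_assoc, ← hu, hx']
          -- Here W denotes the old limit and g = W v. Since W = W v x⁻¹ u and y = u x, the new
          -- tracked product is W u v = W x = g x⁻¹ y.
          · refine ⟨g * x⁻¹ * y, mul_mem (mul_mem hg (inv_mem hxH)) hyH, ?_⟩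
            rw [MaximalSubgroup.coe_mul, MaximalSubgroup.coe_mul, hgw, hw, ← hy', ← mul_assoc, h,
              mul_assoc, ← hx', hu]
      | b =>
        refine Or.inl ⟨⟨Letter.a :: l, rfl⟩, ?_⟩
        rcases ih with ⟨-, g, hg, hgw⟩ | ⟨-, ⟨g, hg, hgw⟩, h⟩
        · refine ⟨g * x⁻¹ * z, mul_mem (mul_mem hg (inv_mem hxH)) hzH, ?_⟩
          rw [MaximalSubgroup.coe_mul, MaximalSubgroup.coe_mul, ← hz', ← mul_assoc, mul_assoc g.1,
            x.inv_mul_coe, g.mul_one_coe, hgw, hw]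
        · exact ⟨g, hg, by rw [hgw, hw]⟩
  rcases key l with h | h
  · exact h.2
  · exact absurd hl h.1

theorem abb_prefix_iterate (k : ℕ) :
    [Letter.a, .b, .b] <+: thueMorseList^[2 * (k + 1)] [Letter.a] := by
  induction k with
  | zero => exact ⟨[.a], rfl⟩
  | succ k ih =>
    rw [show 2 * (k + 1 + 1) = 2 + 2 * (k + 1) by ring, Function.iterate_add_apply]
    exact List.IsPrefix.trans ⟨[.a, .b, .a, .a, .b, .b, .a, .a, .b], rfl⟩
      (thueMorseList.iterate_prefix_map 2 ih)

theorem aab_suffix_iterate (k : ℕ) :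
    [Letter.a, .a, .b] <:+ thueMorseList^[2 * (k + 1)] [Letter.b] := by
  induction k with
  | zero => exact ⟨[.b], rfl⟩
  | succ k ih =>
    rw [show 2 * (k + 1 + 1) = 2 + 2 * (k + 1) by ring, Function.iterate_add_apply]
    exact List.IsSuffix.trans ⟨[.a, .b, .b, .a, .a, .b, .b, .a, .b], rfl⟩
      (thueMorseList.iterate_suffix_map 2 ih)

/-- The maximal subgroup is topologically generated by three elements. -/
theorem dense_closure (hx : x.1 = thueMorseLimit ⟨.a, [.b]⟩)
    (hy : y.1 = thueMorseLimit ⟨.a, [.a, .b]⟩) (hz : z.1 = thueMorseLimit ⟨.a, [.b, .b]⟩)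
    (ha : e * thueMorseLimit (.of .a) = thueMorseLimit (.of .a)) :
    Dense ((Subgroup.closure ({x, y, z} : Set (MaximalSubgroup e he)) :
      Subgroup (MaximalSubgroup e he)) : Set (MaximalSubgroup e he)) := by
  have key : ∀ (g : MaximalSubgroup e he) (c : FinCon Letter),
      ∃ h ∈ Subgroup.closure ({x, y, z} : Set (MaximalSubgroup e he)), h.1.1 c = g.1.1 c := by
    intro g c
    have hg : g.1 ∈ closure (ofWord '' thueMorseLanguage) := by
      refine mem_closure_of_mul_mem prefix_mem_thueMorseLanguage (y := (g⁻¹).1) ?_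
      rw [g.mul_inv_coe]
      exact (idempotent_mem_thueMorseJ hx).1
    obtain ⟨K, hK⟩ := exists_isThueMorsePeriod c
    set p := thueMorseList^[K] [.a, .b, .b] with hp
    set s := thueMorseList^[K] [.a, .a, .b] with hs
    set c' := FinCon.inf c (FinCon.inf (FinCon.prefixCon p.length) (FinCon.suffixCon s.length))
      with hc'
    have hc1 : c'.1 ≤ c.1 := FinCon.inf_le_left _ _
    have hc2 : c'.1 ≤ (FinCon.prefixCon p.length).1 :=
      (FinCon.inf_le_right _ _).trans (FinCon.inf_le_left _ _)
    have hc3 : c'.1 ≤ (FinCon.suffixCon s.length).1 :=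
      (FinCon.inf_le_right _ _).trans (FinCon.inf_le_right _ _)
    obtain ⟨K', hK'⟩ := exists_isThueMorsePeriod c'
    have hK'' := hK'.mul_left (i := K + 1) (by omega)
    -- This period of `c'` exceeds K by a positive even number, so the corresponding iterate of ab
    -- starts with τ^K(abb) and ends with τ^K(aab).
    obtain ⟨k, hk⟩ : ∃ k, (K + 1) * K' = K + 2 * (k + 1) := by
      obtain ⟨m, hm⟩ := hK.1
      obtain ⟨m', hm'⟩ := hK'.1
      have : 0 < m' := by have := hK'.2.1; omega
      obtain ⟨m', rfl⟩ : ∃ j, m' = j + 1 := ⟨m' - 1, by omega⟩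
      refine ⟨4 * (m' + 1) * (8 * m) - 4 * m + 4 * (m' + 1) - 1, ?_⟩
      have h1 : 4 * m ≤ 4 * (m' + 1) * (8 * m) := by nlinarith
      obtain ⟨d, hd⟩ := Nat.exists_eq_add_of_le h1
      rw [hd, hm, hm']
      have : 4 * m + d - 4 * m + 4 * (m' + 1) - 1 + 1 = d + 4 * (m' + 1) := by omega
      rw [this]
      linarith
    rw [hk] at hK''
    obtain ⟨w, hwL, hw⟩ := mem_closure_ofWord_iff.1 hg c'
    have hab : (thueMorse^[K + 2 * (k + 1)] ⟨.a, [.b]⟩).toList =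
        thueMorseList^[K] (thueMorseList^[2 * (k + 1)] [.a]) ++
          thueMorseList^[K] (thueMorseList^[2 * (k + 1)] [.b]) := by
      rw [toList_thueMorse_iterate, ← Function.iterate_add_apply, ← Function.iterate_add_apply,
        ← thueMorseList.iterate_append]
      rfl
    -- As g = x x⁻¹ g, the class of w is that of a word starting with a high iterate of ab, and `c'`
    -- is fine enough to compare prefixes of length |p|. Suffixes are treated with g x⁻¹ x.
    have hpre : p <+: w.toList := by
      obtain ⟨w', hw'⟩ := exists_word ((x⁻¹).1 * g.1) c'
      have h1 : g.1.1 c' = ((thueMorse^[K + 2 * (k + 1)] ⟨.a, [.b]⟩ * w' :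
          FreeSemigroup Letter) : c'.1.Quotient) := by
        rw [Con.coe_mul, ← hw', ← thueMorseLimit_apply hK'', ← hx, ← mul_apply, ← mul_assoc,
          x.mul_inv_coe, g.one_mul_coe]
      have h2 := FinCon.prefixCon_iff.1 ((g.1.2 _ _ hc2 _ hw).symm.trans (g.1.2 _ _ hc2 _ h1))
      obtain ⟨r, hr⟩ := thueMorseList.iterate_prefix_map K (abb_prefix_iterate k)
      rw [FreeSemigroup.toList_mul, hab, ← hr, ← hp, List.append_assoc, List.append_assoc,
        List.take_left] at h2
      rw [← h2]
      exact List.take_prefix _ _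
    have hsuf : s <:+ w.toList := by
      obtain ⟨w', hw'⟩ := exists_word (g.1 * (x⁻¹).1) c'
      have h1 : g.1.1 c' = ((w' * thueMorse^[K + 2 * (k + 1)] ⟨.a, [.b]⟩ :
          FreeSemigroup Letter) : c'.1.Quotient) := by
        rw [Con.coe_mul, ← hw', ← thueMorseLimit_apply hK'', ← hx, ← mul_apply, mul_assoc,
          x.inv_mul_coe, g.mul_one_coe]
      have h2 := FinCon.suffixCon_iff.1 ((g.1.2 _ _ hc3 _ hw).symm.trans (g.1.2 _ _ hc3 _ h1))
      obtain ⟨r, hr⟩ := thueMorseList.iterate_suffix_map K (aab_suffix_iterate k)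
      rw [FreeSemigroup.toList_mul, hab, ← hr, ← hs, ← List.append_assoc, ← List.append_assoc,
        List.reverse_append (bs := s), ← List.length_reverse (as := s), List.take_left] at h2
      rw [← List.reverse_prefix, ← h2]
      exact List.take_prefix _ _
    -- Desubstituting K times turns the class of w modulo `c` into that of lim(m), because K is a
    -- period of `c`.
    obtain ⟨m, hm, hm1, hm2⟩ :=
      (mem_thueMorseLanguage_iff.1 hwL).exists_eq_iterate K hpre hsuf
    obtain ⟨r, rfl⟩ := hm1
    obtain ⟨h, hh, hhw⟩ := exists_mem_closure_eq_thueMorseLimit hx hy hz ha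
      (l := .b :: .b :: r) (List.IsSuffix.trans ⟨[.a, .a], rfl⟩ hm2)
    refine ⟨h, hh, ?_⟩
    rw [hhw, thueMorseLimit_apply hK, g.1.2 _ _ hc1 _ hw]
    congr 1
    refine FreeSemigroup.toList_injective ?_
    rw [toList_thueMorse_iterate, hm]
    rfl
  intro g
  rw [_root_.mem_closure_iff]
  intro U hU hgU
  obtain ⟨V, hV, rfl⟩ := isOpen_induced_iff.1 hU
  obtain ⟨c, hc⟩ := exists_apply_eq_subset hV hgU
  obtain ⟨h, hh, hhc⟩ := key g c
  exact ⟨h, hc _ hhc, hh⟩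

end Idempotent

/-! ### Mutual divisibility in the J-class -/

/-- Every element of the `J`-class is a multiple of every other one. -/
theorem exists_eq_mul_mul {x y : FreeProfiniteSemigroup Letter} (hx : x ∈ thueMorseJ)
    (hy : y ∈ thueMorseJ) : ∃ p q, x = p * y * q := by
  -- Uniform recurrence makes each set of solutions modulo `c` nonempty: a long word approximating x
  -- contains a word approximating y. Compactness then yields a solution valid for all congruences.
  let Z : FinCon Letter → Set (FreeProfiniteSemigroup Letter × FreeProfiniteSemigroup Letter) :=
    fun c => {r | (r.1 * y * r.2).1 c = x.1 c}
  have hclosed : ∀ c, IsClosed (Z c) := fun c =>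
    (isClosed_discrete {x.1 c}).preimage ((continuous_apply c).comp
      ((continuous_fst.mul continuous_const).mul continuous_snd))
  have hne : ∀ c, (Z c).Nonempty := by
    intro c
    obtain ⟨w, hwL, hw⟩ := mem_closure_ofWord_iff.1 hy.1 c
    obtain ⟨N, hN⟩ := InThueMorse.exists_length_infix (mem_thueMorseLanguage_iff.1 hwL)
    obtain ⟨v, hvL, hv, hlen⟩ := exists_long_word hx N c
    obtain ⟨p, q, hp, hq, h⟩ := hN v.toList (mem_thueMorseLanguage_iff.1 hvL) hlen
    obtain ⟨p, rfl⟩ := FreeSemigroup.exists_toList_eq hp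
    obtain ⟨q, rfl⟩ := FreeSemigroup.exists_toList_eq hq
    have hv' : v = p * w * q := FreeSemigroup.toList_injective h
    refine ⟨(ofWord p, ofWord q), ?_⟩
    change (ofWord p * y * ofWord q).1 c = x.1 c
    rw [hv, hv', mul_apply, mul_apply, hw]
    rfl
  have hdir : Directed (· ⊇ ·) Z := fun c d => ⟨FinCon.inf c d,
    fun r hr => apply_eq_of_le (FinCon.inf_le_left c d) hr,
    fun r hr => apply_eq_of_le (FinCon.inf_le_right c d) hr⟩
  have : Nonempty (FinCon Letter) := ⟨FinCon.prefixCon 0⟩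
  obtain ⟨⟨p, q⟩, h⟩ := IsCompact.nonempty_iInter_of_directed_nonempty_isCompact_isClosed Z hdir hne
    (fun c => (hclosed c).isCompact) hclosed
  exact ⟨p, q, (ext_apply fun c => Set.mem_iInter.1 h c).symm⟩

end FreeProfiniteSemigroup

/-! The group of order 18 -/

namespace GroupEighteen

instance : DecidableEq GroupEighteen := fun _ _ => decidable_of_iff' _ SemidirectProduct.ext_iff

instance : Finite GroupEighteen := Finite.of_equiv _ SemidirectProduct.equivProd.symm

instance : DiscreteTopology GroupEighteen := ⟨rfl⟩

theorem card_eq : Nat.card GroupEighteen = 18 := by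
  rw [SemidirectProduct.card, Nat.card_prod]
  simp [Nat.card_eq_fintype_card, ZMod.card]

/-- A reflection. -/
def reflection : GroupEighteen := ⟨1, Multiplicative.ofAdd 1⟩

/-- The first basic translation. -/
def translationLeft : GroupEighteen := ⟨(Multiplicative.ofAdd 1, 1), 1⟩

/-- The second basic translation. -/
def translationRight : GroupEighteen := ⟨(1, Multiplicative.ofAdd (-1)), 1⟩

theorem eq_top_of_mem {K : Subgroup GroupEighteen} (h1 : reflection ∈ K)
    (h2 : translationLeft ∈ K) (h3 : translationRight ∈ K) : K = ⊤ := by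
  rw [eq_top_iff]
  rintro ⟨⟨p, q⟩, r⟩ -
  have key : ∀ (p q : Multiplicative (ZMod 3)) (r : Multiplicative (ZMod 2)),
      ∃ (i j : Fin 3) (k : Fin 2), (⟨(p, q), r⟩ : GroupEighteen) =
        translationLeft ^ i.1 * translationRight ^ j.1 * reflection ^ k.1 := by
    decide
  obtain ⟨i, j, k, h⟩ := key p q r
  rw [h]
  exact mul_mem (mul_mem (pow_mem h2 _) (pow_mem h3 _)) (pow_mem h1 _)

theorem inversionAction_apply (r : Multiplicative (ZMod 2))
    (v : Multiplicative (ZMod 3) × Multiplicative (ZMod 3)) :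
    inversionAction r v = if r = 1 then v else v⁻¹ := by
  change (if r = 1 then (1 : MulAut _) else MulEquiv.inv _) v = _
  split_ifs <;> rfl

/-- The elements that preserve a line in the affine plane over the field with three elements. -/
def lineStabilizer (α β γ : ZMod 3) : Subgroup GroupEighteen where
  -- For the action v ↦ ±v + t, with (α, β) nonzero, the line is αv₁ + βv₂ = -γ, as -γ is half of γ
  -- modulo 3.
  carrier := {h | α * h.left.1.toAdd + β * h.left.2.toAdd = if h.right = 1 then 0 else γ}
  one_mem' := by simp
  mul_mem' := by
    intro h k hh hk
    have two : ∀ r s : Multiplicative (ZMod 2), r ≠ 1 → s ≠ 1 → r * s = 1 := by decide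
    simp only [Set.mem_ofPred_eq, SemidirectProduct.mul_left, SemidirectProduct.mul_right,
      inversionAction_apply] at hh hk ⊢
    by_cases hr : h.right = 1 <;> by_cases kr : k.right = 1
    · simp only [hr, kr, if_true, one_mul, Prod.fst_mul, Prod.snd_mul, toAdd_mul] at hh hk ⊢
      linear_combination hh + hk
    · simp only [hr, kr, if_true, if_false, one_mul, Prod.fst_mul, Prod.snd_mul, toAdd_mul] at hh hk ⊢
      linear_combination hh + hk
    · simp only [hr, kr, if_true, if_false, mul_one, Prod.fst_mul, Prod.snd_mul, toAdd_mul,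
        Prod.fst_inv, Prod.snd_inv, toAdd_inv] at hh hk ⊢
      linear_combination hh - hk
    · simp only [hr, kr, two _ _ hr kr, if_true, if_false, Prod.fst_mul, Prod.snd_mul, toAdd_mul,
        Prod.fst_inv, Prod.snd_inv, toAdd_inv] at hh hk ⊢
      linear_combination hh - hk
  inv_mem' := by
    intro h hh
    simp only [Set.mem_ofPred_eq, SemidirectProduct.inv_left, SemidirectProduct.inv_right,
      inversionAction_apply, inv_eq_one] at hh ⊢
    by_cases hr : h.right = 1
    · simp only [hr, if_true, Prod.fst_inv, Prod.snd_inv, toAdd_inv] at hh ⊢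
      linear_combination -hh
    · simp only [hr, if_false, inv_inv] at hh ⊢
      exact hh

theorem mem_lineStabilizer {α β γ : ZMod 3} {h : GroupEighteen} : h ∈ lineStabilizer α β γ ↔
    α * h.left.1.toAdd + β * h.left.2.toAdd = if h.right = 1 then 0 else γ := Iff.rfl

theorem lineStabilizer_ne_top {α β : ZMod 3} (h : α ≠ 0 ∨ β ≠ 0) (γ : ZMod 3) :
    lineStabilizer α β γ ≠ ⊤ := by
  intro htop
  have h1 : translationLeft ∈ lineStabilizer α β γ := htop ▸ Subgroup.mem_top _
  have h2 : translationRight ∈ lineStabilizer α β γ := htop ▸ Subgroup.mem_top _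
  rw [mem_lineStabilizer] at h1 h2
  simp [translationLeft, translationRight] at h1 h2
  tauto

/-- Two translations lie in the kernel of the projection to C₂. A translation and a reflection
preserve the line through the centre of the reflection along the translation; two reflections
preserve a line through their centres. -/
theorem exists_ne_top_mem (p q : GroupEighteen) :
    ∃ K : Subgroup GroupEighteen, K ≠ ⊤ ∧ p ∈ K ∧ q ∈ K := by
  have line : ∀ v w : ZMod 3, ∃ α β : ZMod 3, (α ≠ 0 ∨ β ≠ 0) ∧ α * v + β * w = 0 := by decide
  by_cases hp : p.right = 1 <;> by_cases hq : q.right = 1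
  · refine ⟨(SemidirectProduct.rightHom).ker, fun h => ?_, hp, hq⟩
    have : reflection ∈ (SemidirectProduct.rightHom (φ := inversionAction)).ker :=
      h ▸ Subgroup.mem_top _
    exact absurd this (by rw [MonoidHom.mem_ker]; decide)
  · obtain ⟨α, β, h, h'⟩ := line p.left.1.toAdd p.left.2.toAdd
    refine ⟨lineStabilizer α β (α * q.left.1.toAdd + β * q.left.2.toAdd),
      lineStabilizer_ne_top h _, ?_, ?_⟩ <;> simp [mem_lineStabilizer, hp, hq, h']
  · obtain ⟨α, β, h, h'⟩ := line q.left.1.toAdd q.left.2.toAdd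
    refine ⟨lineStabilizer α β (α * p.left.1.toAdd + β * p.left.2.toAdd),
      lineStabilizer_ne_top h _, ?_, ?_⟩ <;> simp [mem_lineStabilizer, hp, hq, h']
  · obtain ⟨α, β, h, h'⟩ :=
      line (q.left.1.toAdd - p.left.1.toAdd) (q.left.2.toAdd - p.left.2.toAdd)
    refine ⟨lineStabilizer α β (α * p.left.1.toAdd + β * p.left.2.toAdd),
      lineStabilizer_ne_top h _, ?_, ?_⟩
    · simp [mem_lineStabilizer, hp]
    · simp only [mem_lineStabilizer, hq, if_false]
      linear_combination h'

theorem three_le_card {s : Finset GroupEighteen}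
    (hs : Dense ((Subgroup.closure (s : Set GroupEighteen) : Subgroup GroupEighteen) :
      Set GroupEighteen)) : 3 ≤ s.card := by
  rw [dense_discrete, Subgroup.coe_eq_univ] at hs
  by_contra! hcon
  obtain ⟨p, q, hpq⟩ : ∃ p q, s ⊆ {p, q} := by
    rcases Nat.lt_succ_iff_lt_or_eq.1 hcon with h | h
    · obtain ⟨p, hp⟩ := Finset.card_le_one_iff_subset_singleton.1 (Nat.lt_succ_iff.1 h)
      exact ⟨p, p, by simpa using hp⟩
    · obtain ⟨p, q, -, rfl⟩ := Finset.card_eq_two.1 h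
      exact ⟨p, q, le_rfl⟩
  obtain ⟨K, hK, hp, hq⟩ := exists_ne_top_mem p q
  refine hK (top_le_iff.1 (hs ▸ (Subgroup.closure_le K).2 fun x hx => ?_))
  have := hpq hx
  simp only [Finset.mem_insert, Finset.mem_singleton] at this
  rcases this with rfl | rfl
  · exact hp
  · exact hq

theorem hasTopologicalRank : HasTopologicalRank GroupEighteen 3 := by
  refine ⟨⟨{reflection, translationLeft, translationRight}, by decide, ?_⟩, ?_⟩
  · rw [dense_discrete, Subgroup.coe_eq_univ]
    exact eq_top_of_mem (Subgroup.subset_closure (by simp)) (Subgroup.subset_closure (by simp))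
      (Subgroup.subset_closure (by simp))
  · rintro m ⟨s, rfl, hs⟩
    exact three_le_card hs

end GroupEighteen

/-! A labelling of the edges of the de Bruijn graph -/

/-- Functions from states to a group together with a final state. -/
def Labelling (Q G : Type) : Type := (Q → G) × Q

namespace Labelling

variable {Q G : Type} [Group G]

instance [Finite Q] [Finite G] : Finite (Labelling Q G) := inferInstanceAs (Finite ((Q → G) × Q))

instance : TopologicalSpace (Labelling Q G) := ⊥

instance : DiscreteTopology (Labelling Q G) := ⟨rfl⟩

/-- The product concatenates paths. -/
instance : Semigroup (Labelling Q G) where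
  mul s t := (fun x => s.1 x * t.1 s.2, t.2)
  mul_assoc r s t := Prod.ext (funext fun x => mul_assoc (r.1 x) (s.1 r.2) (t.1 s.2)) rfl

theorem mul_fst (s t : Labelling Q G) (x : Q) : (s * t).1 x = s.1 x * t.1 s.2 := rfl

theorem mul_snd (s t : Labelling Q G) : (s * t).2 = t.2 := rfl

end Labelling

open GroupEighteen in
/-- The label of the two-letter block `xy`. -/
def edgeLabel : Letter → Letter → GroupEighteen
  -- With ba labelled trivially, the loops at b spelling ab, aab and abb have as labels
  -- `reflection`, `translationLeft` and `translationRight`.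
  | .b, .a => 1
  | .a, .a => ⟨(Multiplicative.ofAdd 1, 1), Multiplicative.ofAdd 1⟩
  | .a, .b => reflection
  | .b, .b => ⟨(1, Multiplicative.ofAdd 1), Multiplicative.ofAdd 1⟩

/-- The labels of the paths in the de Bruijn graph that spell a word. -/
def wordLabel : FreeSemigroup Letter →ₙ* Labelling Letter GroupEighteen :=
  FreeSemigroup.lift fun y => (fun x => edgeLabel x y, y)

/-- Both sides are homomorphisms, so only the four pairs of a starting state and a letter are to be
checked. -/
theorem wordLabel_thueMorse_iterate_four (w : FreeSemigroup Letter) :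
    wordLabel (thueMorse^[4] w) = wordLabel w := by
  induction w using FreeSemigroup.recOnMul with
  | ih1 y =>
    refine Prod.ext (funext fun x => ?_) ?_
    · cases x <;> cases y <;> decide
    · cases y <;> rfl
  | ih2 u v hu hv => rw [iterate_map_mul, map_mul, map_mul, hu, hv]

theorem wordLabel_thueMorse_iterate {K : ℕ} (hK : 4 ∣ K) (w : FreeSemigroup Letter) :
    wordLabel (thueMorse^[K] w) = wordLabel w := by
  obtain ⟨k, rfl⟩ := hK
  induction k with
  | zero => rfl
  | succ k ih =>
    rw [mul_add, mul_one, add_comm, Function.iterate_add_apply, wordLabel_thueMorse_iterate_four, ih]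

/-! ### The homomorphism onto the group of order 18 -/

namespace FreeProfiniteSemigroup

theorem extend_wordLabel_thueMorseLimit (w : FreeSemigroup Letter) :
    extend wordLabel (thueMorseLimit w) = wordLabel w := by
  obtain ⟨K, hK⟩ := exists_isThueMorsePeriod (FinCon.ker wordLabel)
  rw [extend_eq wordLabel (c := FinCon.ker wordLabel) le_rfl (thueMorseLimit_apply hK w),
    wordLabel_thueMorse_iterate ((by norm_num : 4 ∣ 8).trans hK.1)]

variable {e : FreeProfiniteSemigroup Letter} {he : e * e = e}

theorem extend_wordLabel_snd (g : MaximalSubgroup e he) :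
    (extend wordLabel g.1).2 = (extend wordLabel e).2 := by
  rw [← g.mul_one_coe, map_mul, Labelling.mul_snd]

/-- The homomorphism that sends an element of a maximal subgroup to the label of a loop. -/
noncomputable def loopLabel (e : FreeProfiniteSemigroup Letter) (he : e * e = e) :
    MaximalSubgroup e he →* GroupEighteen :=
  MonoidHom.mk' (fun g => (extend wordLabel g.1).1 (extend wordLabel e).2) fun g h => by
    rw [MaximalSubgroup.coe_mul, map_mul, Labelling.mul_fst, extend_wordLabel_snd]

theorem loopLabel_apply (g : MaximalSubgroup e he) :
    loopLabel e he g = (extend wordLabel g.1).1 (extend wordLabel e).2 := rfl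

theorem continuous_loopLabel : Continuous (loopLabel e he) :=
  (continuous_of_discreteTopology (f := fun s : Labelling Letter GroupEighteen =>
    s.1 (extend wordLabel e).2)).comp ((continuous_extend wordLabel).comp continuous_subtype_val)

section

variable {x y z : MaximalSubgroup e he}

/-- The base state is b: all elements of the group have the same final state, and lim(ab) ends in
state b. -/
theorem loopLabel_eq (hx : x.1 = thueMorseLimit ⟨.a, [.b]⟩) {g : MaximalSubgroup e he}
    {w : FreeSemigroup Letter} (hg : g.1 = thueMorseLimit w) :
    loopLabel e he g = (wordLabel w).1 .b := by
  rw [loopLabel_apply, hg, extend_wordLabel_thueMorseLimit, ← extend_wordLabel_snd x, hx,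
    extend_wordLabel_thueMorseLimit]
  rfl

theorem surjective_loopLabel (hx : x.1 = thueMorseLimit ⟨.a, [.b]⟩)
    (hy : y.1 = thueMorseLimit ⟨.a, [.a, .b]⟩) (hz : z.1 = thueMorseLimit ⟨.a, [.b, .b]⟩) :
    Function.Surjective (loopLabel e he) := by
  rw [← MonoidHom.range_eq_top]
  exact GroupEighteen.eq_top_of_mem ⟨x, (loopLabel_eq hx hx).trans (by decide)⟩
    ⟨y, (loopLabel_eq hx hy).trans (by decide)⟩ ⟨z, (loopLabel_eq hx hz).trans (by decide)⟩

theorem hasTopologicalRank_maximalSubgroup (hx : x.1 = thueMorseLimit ⟨.a, [.b]⟩)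
    (hy : y.1 = thueMorseLimit ⟨.a, [.a, .b]⟩) (hz : z.1 = thueMorseLimit ⟨.a, [.b, .b]⟩)
    (ha : e * thueMorseLimit (.of .a) = thueMorseLimit (.of .a)) :
    HasTopologicalRank (MaximalSubgroup e he) 3 := by
  classical
  have lower : ∀ s : Finset (MaximalSubgroup e he),
      Dense ((Subgroup.closure (s : Set (MaximalSubgroup e he)) :
        Subgroup (MaximalSubgroup e he)) : Set (MaximalSubgroup e he)) → 3 ≤ s.card := by
    intro s hs
    obtain ⟨t, ht, htd⟩ := exists_dense_closure_of_surjective _ continuous_loopLabel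
      (surjective_loopLabel hx hy hz) hs
    exact (GroupEighteen.three_le_card htd).trans ht
  refine ⟨⟨{x, y, z}, ?_, ?_⟩, ?_⟩
  -- The lower bound also shows that the three generators are distinct.
  · refine le_antisymm Finset.card_le_three (lower _ ?_)
    simpa using dense_closure hx hy hz ha
  · simpa using dense_closure hx hy hz ha
  · rintro m ⟨s, rfl, hs⟩
    exact lower s hs

end

end FreeProfiniteSemigroup

theorem theoremt :
    Nat.card GroupEighteen = 18 ∧ HasTopologicalRank GroupEighteen 3 ∧
    (∃ e ∈ thueMorseJ, e * e = e) ∧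
    ∀ e ∈ thueMorseJ, ∀ he : e * e = e,
      (∃ f : MaximalSubgroup e he →* GroupEighteen, Continuous f ∧ Function.Surjective f) ∧
      HasTopologicalRank (MaximalSubgroup e he) 3 := by
  obtain ⟨e, he, x, y, z, hx, hy, hz, ha⟩ := FreeProfiniteSemigroup.exists_thueMorse_idempotent
  have heJ : e ∈ thueMorseJ := FreeProfiniteSemigroup.idempotent_mem_thueMorseJ hx
  refine ⟨GroupEighteen.card_eq, GroupEighteen.hasTopologicalRank, ⟨e, heJ, he⟩, ?_⟩
  intro f hfJ hf
  obtain ⟨p, q, hef⟩ := FreeProfiniteSemigroup.exists_eq_mul_mul heJ hfJ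
  obtain ⟨p', q', hfe⟩ := FreeProfiniteSemigroup.exists_eq_mul_mul hfJ heJ
  obtain ⟨φ⟩ := FreeProfiniteSemigroup.nonempty_maximalSubgroup_equiv he hf hef hfe
  exact ⟨⟨(FreeProfiniteSemigroup.loopLabel e he).comp φ.symm.toMulEquiv.toMonoidHom,
    FreeProfiniteSemigroup.continuous_loopLabel.comp φ.symm.continuous,
    (FreeProfiniteSemigroup.surjective_loopLabel hx hy hz).comp φ.symm.surjective⟩,
    (FreeProfiniteSemigroup.hasTopologicalRank_maximalSubgroup hx hy hz ha).of_continuousMulEquiv φ⟩
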